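/- Let $p,q\ge 1$ and $m>n\ge 0$ be integers. Let $\boldsymbol X_i=(P_i,Q_i):\mathbb R^2\to\mathbb R^2$, $i=n,m$, be vector fields of class $C^1$ on $\mathbb R^2\setminus\{0\}$ (for instance polynomial ones) such that $\boldsymbol X_i$ is quasi-homogeneous with weight $(p,q)$ and degree $i$, that is, $$P_i(\lambda^p x,\lambda^q y)=\lambda^{p+i-1}P_i(x,y),\qquad Q_i(\lambda^p x,\lambda^q y)=\lambda^{q+i-1}Q_i(x,y)\qquad\text{for all }\lambda,x,y\in\mathbb R .$$ For $i=n,m$ put $$a_i(\theta)=(m-n)\bigl(\cos\theta\, P_i(\cos\theta,\sin\theta)+\sin\theta\, Q_i(\cos\theta,\sin\theta)\bigr),\qquad b_i(\theta)=p\cos\theta\, Q_i(\cos\theta,\sin\theta)-q\sin\theta\, P_i(\cos\theta,\sin\theta).$$ Suppose that $b_n(\theta)b_m(\theta)>0$ for all $\theta$ and that $$\int_0^{2\pi}\frac{a_n(\theta)}{b_n(\theta)}\,d\theta\cdot\int_0^{2\pi}\frac{a_m(\theta)}{b_m(\theta)}\,d\theta<0 .$$ Then the planar system $\frac{d}{dt}(x,y)=\boldsymbol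 X_n(x,y)+\boldsymbol X_m(x,y)$ has at least one limit cycle (that is, a periodic orbit which has a neighbourhood met by no other periodic orbit) surrounding the origin. -/

import Mathlib

/-- The planar vector field `X = (P, Q)` is quasi-homogeneous with weight `(p, q)` and degree `s`:
`P (l ^ p * x, l ^ q * y) = l ^ (p + s - 1) * P (x, y)` and
`Q (l ^ p * x, l ^ q * y) = l ^ (q + s - 1) * Q (x, y)` for all real `l`.
It is used for `1 ≤ p` and `1 ≤ q` only, so the subtractions of natural numbers are honest. -/
def IsQuasiHomogeneous (p q s : ℕ) (X : ℝ × ℝ → ℝ × ℝ) : Prop :=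
  ∀ l x y : ℝ,
    (X (l ^ p * x, l ^ q * y)).1 = l ^ (p + s - 1) * (X (x, y)).1 ∧
    (X (l ^ p * x, l ^ q * y)).2 = l ^ (q + s - 1) * (X (x, y)).2

/-- `a_i(θ) = (m - n) (cos θ P_i(cos θ, sin θ) + sin θ Q_i(cos θ, sin θ))` for `X_i = (P_i, Q_i)`. -/
noncomputable def aCoeff (n m : ℕ) (X : ℝ × ℝ → ℝ × ℝ) (θ : ℝ) : ℝ :=
  ((m : ℝ) - (n : ℝ)) *
    (Real.cos θ * (X (Real.cos θ, Real.sin θ)).1 + Real.sin θ * (X (Real.cos θ, Real.sin θ)).2)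

/-- `b_i(θ) = p cos θ Q_i(cos θ, sin θ) - q sin θ P_i(cos θ, sin θ)` for `X_i = (P_i, Q_i)`. -/
noncomputable def bCoeff (p q : ℕ) (X : ℝ × ℝ → ℝ × ℝ) (θ : ℝ) : ℝ :=
  (p : ℝ) * Real.cos θ * (X (Real.cos θ, Real.sin θ)).2 -
    (q : ℝ) * Real.sin θ * (X (Real.cos θ, Real.sin θ)).1

/-- `Γ` is a periodic orbit of `d(x,y)/dt = X(x,y)`: the image of a solution defined for all times,
periodic with (minimal) period `T > 0` and injective on `[0, T)` (in particular not constant). -/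
def IsPeriodicOrbit (X : ℝ × ℝ → ℝ × ℝ) (Γ : Set (ℝ × ℝ)) : Prop :=
  ∃ (γ : ℝ → ℝ × ℝ) (T : ℝ), 0 < T ∧ (∀ t, HasDerivAt γ (X (γ t)) t) ∧
    Function.Periodic γ T ∧ Set.InjOn γ (Set.Ico 0 T) ∧ Γ = Set.range γ

/-- A limit cycle is an isolated periodic orbit: some open neighbourhood of it is met by no other
periodic orbit. -/
def IsLimitCycle (X : ℝ × ℝ → ℝ × ℝ) (Γ : Set (ℝ × ℝ)) : Prop :=
  IsPeriodicOrbit X Γ ∧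
    ∃ U : Set (ℝ × ℝ), IsOpen U ∧ Γ ⊆ U ∧
      ∀ Γ' : Set (ℝ × ℝ), IsPeriodicOrbit X Γ' → (Γ' ∩ U).Nonempty → Γ' = Γ

/-- The closed curve `Γ` surrounds the origin: the origin is not on `Γ`, and the connected component
of the complement of `Γ` that contains the origin is bounded. -/
def SurroundsOrigin (Γ : Set (ℝ × ℝ)) : Prop :=
  (0 : ℝ × ℝ) ∉ Γ ∧ Bornology.IsBounded (connectedComponentIn Γᶜ (0 : ℝ × ℝ))

/-! Write x = e^{pu} cos θ, y = e^{qu} sin θ and s = (m - n)u. With w = p cos²θ + q sin²θ,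
quasi-homogeneity gives w s' = Σ e^{(i-1)u} a_i and w θ' = Σ e^{(i-1)u} b_i. After a time reversal
if needed, both b_i are positive, so θ increases and the orbits solve ds/dθ = (a_n + a_m e^s)/(b_n +
b_m e^s). This is the logistic form α + (β - α) σ(s + l), where α = a_n/b_n, β = a_m/b_m, l =
log(b_m/b_n) and σ is the logistic function. It is bounded and globally Lipschitz in s, so the
return map over [0, 2π] is defined on all of ℝ.

The displacement of the return map tends to ∫α as s → -∞ and to ∫β as s → +∞
(`tendsto_displacement`). These limits have opposite signs, so the displacement has a zero. The
equation extends holomorphically to complex s near the real axis, hence so does the return map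
(`exists_holomorphic_extension`). The displacement is therefore analytic and not identically zero,
and its zeros are isolated (`exists_isolated_fixedPoint`).

A fixed point gives a closed curve that is a graph over the angle, hence a periodic orbit around the
origin (`isPeriodicOrbit_orbitCurve`, `surroundsOrigin_starCurve`). A periodic orbit meeting a thin
neighbourhood of it has initial values near the fixed point s₀. By compactness one of them is
closest to s₀. The return map and its inverse are increasing and fix s₀, so one of them would move a
non-fixed closest value still closer. Hence the closest value is s₀ and the orbits coincide. -/

open Set Filter Topology

open scoped NNReal

/-! ### Global flows of bounded Lipschitz fields -/

section ScalarFlow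

variable {E : Type*} [NormedAddCommGroup E] [NormedSpace ℝ E] {F : ℝ → E → E} {K : ℝ≥0}

/-- A bounded, globally Lipschitz time-dependent vector field has global solutions. -/
theorem exists_global_solution [CompleteSpace E] {M : ℝ≥0} (hc : ∀ x, Continuous (F · x))
    (hL : ∀ t, LipschitzWith K (F t)) (hM : ∀ t x, ‖F t x‖ ≤ M) (t₀ : ℝ) (x₀ : E) :
    ∃ f : ℝ → E, f t₀ = x₀ ∧ ∀ t, HasDerivAt f (F t (f t)) t := by
  have local_sol : ∀ N : ℕ, ∃ f : ℝ → E, f t₀ = x₀ ∧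
      ∀ t ∈ Ioo (t₀ - (N + 1)) (t₀ + (N + 1)), HasDerivAt f (F t (f t)) t := by
    intro N
    have hN : (0 : ℝ) ≤ N + 1 := by positivity
    -- As the speed is at most M, the ball of radius M(N + 1) is not left within time N + 1, so N is
    -- unrestricted.
    have hpl : IsPicardLindelof F (tmin := t₀ - (N + 1)) (tmax := t₀ + (N + 1))
        ⟨t₀, by constructor <;> linarith⟩ x₀ (M * (N + 1)) 0 M K := by
      refine ⟨fun t _ => (hL t).lipschitzOnWith, fun x _ => (hc x).continuousOn,
        fun t _ x _ => hM t x, ?_⟩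
      simp
    obtain ⟨f, h0, hf⟩ := hpl.exists_eq_forall_mem_Icc_hasDerivWithinAt₀
    exact ⟨f, h0, fun t ht => (hf t (Ioo_subset_Icc_self ht)).hasDerivAt (Icc_mem_nhds ht.1 ht.2)⟩
  choose f h0 hf using local_sol
  have mono : ∀ k N : ℕ, k ≤ N → EqOn (f k) (f N) (Ioo (t₀ - (k + 1)) (t₀ + (k + 1))) := by
    intro k N hkN
    have hkN' : (k : ℝ) ≤ N := by exact_mod_cast hkN
    have hk : (0 : ℝ) ≤ k := by positivity
    refine ODE_solution_unique_of_mem_Ioo (t₀ := t₀) (v := F) (K := K) (s := fun _ => univ)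
      (fun t _ => (hL t).lipschitzOnWith) (by constructor <;> linarith)
      (fun t ht => ⟨hf k t ht, trivial⟩) (fun t ht => ⟨hf N t ?_, trivial⟩) (by rw [h0, h0])
    constructor <;> linarith [ht.1, ht.2]
  have mem : ∀ t, t ∈ Ioo (t₀ - (⌈|t - t₀|⌉₊ + 1)) (t₀ + (⌈|t - t₀|⌉₊ + 1)) := by
    intro t
    have h1 := Nat.le_ceil |t - t₀|
    constructor <;> linarith [neg_abs_le (t - t₀), le_abs_self (t - t₀)]
  have key : ∀ N : ℕ, EqOn (fun t => f ⌈|t - t₀|⌉₊ t) (f N) (Ioo (t₀ - (N + 1)) (t₀ + (N + 1))) := by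
    intro N t ht
    rcases le_total ⌈|t - t₀|⌉₊ N with h | h
    · exact mono _ _ h (mem t)
    · exact (mono _ _ h ht).symm
  refine ⟨fun t => f ⌈|t - t₀|⌉₊ t, h0 _, fun t => ?_⟩
  exact (hf _ t (mem t)).congr_of_eventuallyEq
    ((key ⌈|t - t₀|⌉₊).eventuallyEq_of_mem (Ioo_mem_nhds (mem t).1 (mem t).2))

theorem solution_unique (hL : ∀ t, LipschitzWith K (F t)) {f g : ℝ → E}
    (hf : ∀ t, HasDerivAt f (F t (f t)) t) (hg : ∀ t, HasDerivAt g (F t (g t)) t) {t₀ : ℝ}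
    (h : f t₀ = g t₀) : f = g :=
  ODE_solution_unique_univ (s := fun _ => univ) (fun t => (hL t).lipschitzOnWith)
    (fun t => ⟨hf t, trivial⟩) (fun t => ⟨hg t, trivial⟩) h

theorem dist_solution_le (hL : ∀ t, LipschitzWith K (F t)) {f g : ℝ → E}
    (hf : ∀ t, HasDerivAt f (F t (f t)) t) (hg : ∀ t, HasDerivAt g (F t (g t)) t) {a b : ℝ}
    (hab : a ≤ b) : dist (f b) (g b) ≤ dist (f a) (g a) * Real.exp (K * (b - a)) :=
  dist_le_of_trajectories_ODE hL (fun t _ => (hf t).continuousAt.continuousWithinAt)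
    (fun t _ => (hf t).hasDerivWithinAt) (fun t _ => (hg t).continuousAt.continuousWithinAt)
    (fun t _ => (hg t).hasDerivWithinAt) le_rfl b ⟨hab, le_rfl⟩

theorem dist_solution_le' (hL : ∀ t, LipschitzWith K (F t)) {f g : ℝ → E}
    (hf : ∀ t, HasDerivAt f (F t (f t)) t) (hg : ∀ t, HasDerivAt g (F t (g t)) t) {a b : ℝ}
    (hab : a ≤ b) : dist (f a) (g a) ≤ dist (f b) (g b) * Real.exp (K * (b - a)) := by
  have hneg : ∀ h : ℝ → E, (∀ t, HasDerivAt h (F t (h t)) t) →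
      ∀ t, HasDerivAt (fun t => h (-t)) (-F (-t) (h (-t))) t := by
    intro h hh t
    simpa [Function.comp_def] using (hh (-t)).scomp t (hasDerivAt_neg t)
  have := dist_solution_le (F := fun t x => -F (-t) x) (K := K) (fun t => (hL (-t)).neg)
    (hneg f hf) (hneg g hg) (neg_le_neg hab)
  simpa [add_comm, sub_eq_add_neg] using this

end ScalarFlow

/-! ### Complex differentiability of the flow -/

/-- The time-`T` map of a globally Lipschitz complex field is complex differentiable at a point
whose trajectory runs through points where the field is complex differentiable. -/
theorem differentiableAt_flow {F : ℝ → ℂ → ℂ} {K : ℝ≥0}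
    (hc : ∀ x, Continuous (F · x)) (hL : ∀ t, LipschitzWith K (F t)) {W : ℂ → ℝ → ℂ}
    (hW0 : ∀ z, W z 0 = z) (hW : ∀ z t, HasDerivAt (W z) (F t (W z t)) t) {T : ℝ} (hT : 0 ≤ T)
    {z₀ : ℂ} (hd : ∀ t ∈ Icc 0 T, DifferentiableAt ℂ (F t) (W z₀ t)) :
    DifferentiableAt ℂ (fun z => W z T) z₀ := by
  have hWc : ∀ z, Continuous (W z) := fun z =>
    continuous_iff_continuousAt.2 fun t => (hW z t).continuousAt
  have hFc : Continuous (Function.uncurry F) :=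
    continuous_prod_of_continuous_lipschitzWith' _ K hL hc
  have hFW : ∀ z, Continuous fun t => F t (W z t) := fun z =>
    hFc.comp (continuous_id.prodMk (hWc z))
  have hne : ∀ z, z ≠ z₀ → ∀ t, W z t - W z₀ t ≠ 0 := by
    intro z hz t h
    have := solution_unique hL (hW z) (hW z₀) (sub_eq_zero.1 h)
    exact hz (by rw [← hW0 z, ← hW0 z₀, this])
  -- The difference of two trajectories solves the linear equation D' = A D, with the difference
  -- quotient A bounded by K. Solving it explicitly leaves only a dominated convergence argument as
  -- z → z₀.
  set A : ℂ → ℝ → ℂ := fun z t => (F t (W z t) - F t (W z₀ t)) / (W z t - W z₀ t) with hA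
  have hAc : ∀ z, z ≠ z₀ → Continuous (A z) := fun z hz =>
    ((hFW z).sub (hFW z₀)).div ((hWc z).sub (hWc z₀)) (hne z hz)
  have hAK : ∀ z t, ‖A z t‖ ≤ K := by
    intro z t
    rw [hA]
    simp only [norm_div]
    refine div_le_of_le_mul₀ (norm_nonneg _) K.2 ?_
    simpa [dist_eq_norm] using (hL t).dist_le_mul (W z t) (W z₀ t)
  have hexp : ∀ z, z ≠ z₀ →
      W z T - W z₀ T = (z - z₀) * Complex.exp (∫ t in (0 : ℝ)..T, A z t) := by
    intro z hz
    have hI : ∀ t, HasDerivAt (fun t => ∫ s in (0 : ℝ)..t, A z s) (A z t) t := fun t =>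
      intervalIntegral.integral_hasDerivAt_right ((hAc z hz).intervalIntegrable _ _)
        ((hAc z hz).stronglyMeasurableAtFilter _ _) (hAc z hz).continuousAt
    have hg : ∀ t, HasDerivAt
        (fun t => (W z t - W z₀ t) * Complex.exp (-∫ s in (0 : ℝ)..t, A z s)) 0 t := by
      intro t
      have h1 := ((hW z t).sub (hW z₀ t)).mul (hI t).neg.cexp
      refine h1.congr_deriv ?_
      have h2 : F t (W z t) - F t (W z₀ t) = A z t * (W z t - W z₀ t) :=
        (div_mul_cancel₀ _ (hne z hz t)).symm
      simp only [Pi.sub_apply, Pi.neg_apply]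
      rw [h2]; ring
    have hconst := is_const_of_deriv_eq_zero (fun t => (hg t).differentiableAt)
      (fun t => (hg t).deriv) T 0
    simp only [intervalIntegral.integral_same, neg_zero, Complex.exp_zero, mul_one, hW0] at hconst
    rw [← hconst, mul_assoc, ← Complex.exp_add]
    simp
  have hWlim : ∀ t ∈ Icc 0 T, Tendsto (fun z => W z t) (𝓝 z₀) (𝓝 (W z₀ t)) := by
    intro t ht
    rw [tendsto_iff_dist_tendsto_zero]
    have hb : ∀ z, dist (W z t) (W z₀ t) ≤ dist z z₀ * Real.exp (K * (t - 0)) := fun z => by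
      simpa [hW0] using dist_solution_le hL (hW z) (hW z₀) ht.1
    refine squeeze_zero (fun _ => dist_nonneg) hb ?_
    have : Continuous fun z : ℂ => dist z z₀ * Real.exp (K * (t - 0)) := by fun_prop
    simpa using this.tendsto z₀
  have hAlim : ∀ t ∈ Icc 0 T,
      Tendsto (fun z => A z t) (𝓝[≠] z₀) (𝓝 (deriv (F t) (W z₀ t))) := by
    intro t ht
    have h1 := (hd t ht).hasDerivAt.tendsto_slope
    have h2 : Tendsto (fun z => W z t) (𝓝[≠] z₀) (𝓝[≠] (W z₀ t)) := by
      refine tendsto_nhdsWithin_iff.2 ⟨(hWlim t ht).mono_left nhdsWithin_le_nhds, ?_⟩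
      filter_upwards [self_mem_nhdsWithin] with z hz
      exact sub_ne_zero.1 (hne z hz t)
    refine (h1.comp h2).congr fun z => ?_
    simp only [Function.comp, slope_def_field, hA]
  have hint : Tendsto (fun z => ∫ t in (0 : ℝ)..T, A z t) (𝓝[≠] z₀)
      (𝓝 (∫ t in (0 : ℝ)..T, deriv (F t) (W z₀ t))) := by
    refine intervalIntegral.tendsto_integral_filter_of_dominated_convergence (fun _ => (K : ℝ))
      ?_ (Eventually.of_forall fun z => Eventually.of_forall fun t _ => hAK z t)
      intervalIntegrable_const (Eventually.of_forall fun t ht => hAlim t ?_)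
    · filter_upwards [self_mem_nhdsWithin] with z hz
      exact (hAc z hz).aestronglyMeasurable
    · rw [uIoc_of_le hT] at ht
      exact Ioc_subset_Icc_self ht
  have hslope : Tendsto (slope (fun z => W z T) z₀) (𝓝[≠] z₀)
      (𝓝 (Complex.exp (∫ t in (0 : ℝ)..T, deriv (F t) (W z₀ t)))) := by
    refine ((Complex.continuous_exp.tendsto _).comp hint).congr' ?_
    filter_upwards [self_mem_nhdsWithin] with z hz
    simp only [Function.comp, slope_def_field]
    rw [hexp z hz, mul_div_cancel_left₀ _ (sub_ne_zero.2 hz)]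
  exact (hasDerivAt_iff_tendsto_slope.2 hslope).differentiableAt

/-! ### The logistic function on a complex strip -/

/-- The logistic function on `ℂ`, frozen in the imaginary direction outside `|Im w| ≤ 1`. -/
noncomputable def stripSigmoid (w : ℂ) : ℂ :=
  (1 + Complex.exp (-(⟨w.re, max (-1) (min 1 w.im)⟩ : ℂ)))⁻¹

/-- Since 1 < π/2, exp(-w) has positive real part on this strip, which keeps the poles of the
logistic function away. -/
theorem one_le_norm_one_add_exp_neg {w : ℂ} (hw : w.im ∈ Icc (-1 : ℝ) 1) :
    1 ≤ ‖1 + Complex.exp (-w)‖ := by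
  refine le_trans ?_ (Complex.re_le_norm _)
  have hcos : 0 < Real.cos (-w).im := by
    rw [Complex.neg_im, Real.cos_neg]
    exact Real.cos_pos_of_mem_Ioo
      ⟨by linarith [hw.1, Real.pi_gt_three], by linarith [hw.2, Real.pi_gt_three]⟩
  rw [Complex.add_re, Complex.one_re, Complex.exp_re]
  have := mul_pos (Real.exp_pos (-w).re) hcos
  linarith

theorem hasDerivAt_complex_logistic {w : ℂ} (hw : w.im ∈ Icc (-1 : ℝ) 1) :
    HasDerivAt (fun w : ℂ => (1 + Complex.exp (-w))⁻¹)
      (Complex.exp (-w) / (1 + Complex.exp (-w)) ^ 2) w := by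
  have hne : 1 + Complex.exp (-w) ≠ 0 := by
    rw [← norm_pos_iff]; linarith [one_le_norm_one_add_exp_neg hw]
  have h1 : HasDerivAt (fun w : ℂ => 1 + Complex.exp (-w)) (-Complex.exp (-w)) w := by
    simpa using ((hasDerivAt_neg w).cexp).const_add 1
  simpa [Pi.inv_def] using h1.inv hne

/-- With N = ‖1 + exp(-w)‖ ≥ 1, the derivative has norm at most (N + 1)/N² ≤ 2. -/
theorem lipschitzOnWith_complex_logistic :
    LipschitzOnWith 2 (fun w : ℂ => (1 + Complex.exp (-w))⁻¹) {w | w.im ∈ Icc (-1 : ℝ) 1} := by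
  have hconv : Convex ℝ {w : ℂ | w.im ∈ Icc (-1 : ℝ) 1} :=
    (convex_Icc (-1 : ℝ) 1).linear_preimage Complex.imLm
  refine hconv.lipschitzOnWith_of_nnnorm_hasDerivWithin_le
    (fun w hw => (hasDerivAt_complex_logistic hw).hasDerivWithinAt) fun w hw => ?_
  rw [← NNReal.coe_le_coe, coe_nnnorm]
  have h1 := one_le_norm_one_add_exp_neg hw
  have h2 : ‖Complex.exp (-w)‖ ≤ ‖1 + Complex.exp (-w)‖ + 1 := by
    calc ‖Complex.exp (-w)‖ = ‖(1 + Complex.exp (-w)) - 1‖ := by ring_nf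
      _ ≤ _ := by simpa using norm_sub_le (1 + Complex.exp (-w)) 1
  rw [norm_div, norm_pow, div_le_iff₀ (by positivity)]
  norm_num
  nlinarith

theorem clamp_mem (y : ℝ) : max (-1) (min 1 y) ∈ Icc (-1 : ℝ) 1 := by
  constructor <;> simp

theorem norm_stripSigmoid_le (w : ℂ) : ‖stripSigmoid w‖ ≤ 1 := by
  rw [stripSigmoid, norm_inv]
  exact inv_le_one_of_one_le₀ (one_le_norm_one_add_exp_neg (clamp_mem _))

theorem lipschitzWith_stripSigmoid : LipschitzWith 4 stripSigmoid := by
  refine LipschitzWith.of_dist_le_mul fun a b => ?_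
  have h1 := lipschitzOnWith_complex_logistic.dist_le_mul
    (⟨a.re, max (-1) (min 1 a.im)⟩ : ℂ) (clamp_mem a.im)
    (⟨b.re, max (-1) (min 1 b.im)⟩ : ℂ) (clamp_mem b.im)
  have h2 : dist (⟨a.re, max (-1) (min 1 a.im)⟩ : ℂ) ⟨b.re, max (-1) (min 1 b.im)⟩
      ≤ 2 * dist a b := by
    rw [dist_eq_norm, dist_eq_norm]
    refine (Complex.norm_le_abs_re_add_abs_im _).trans ?_
    have hre := Complex.abs_re_le_norm (a - b)
    have him := Complex.abs_im_le_norm (a - b)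
    have hcl : |max (-1) (min 1 a.im) - max (-1) (min 1 b.im)| ≤ |a.im - b.im| := by
      refine (abs_max_sub_max_le_max _ _ _ _).trans ?_
      simpa using abs_min_sub_min_le_max 1 a.im 1 b.im
    simp only [Complex.sub_re, Complex.sub_im] at *
    linarith
  calc _ ≤ ((2 : ℝ≥0) : ℝ) * (2 * dist a b) := h1.trans (by gcongr)
    _ = _ := by push_cast; ring

theorem stripSigmoid_ofReal (x : ℝ) : stripSigmoid x = (Real.sigmoid x : ℝ) := by
  have : (⟨(x : ℂ).re, max (-1) (min 1 (x : ℂ).im)⟩ : ℂ) = x := by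
    apply Complex.ext <;> simp
  rw [stripSigmoid, this, Real.sigmoid_def]
  push_cast
  rfl

theorem differentiableAt_stripSigmoid {w : ℂ} (hw : w.im ∈ Ioo (-1 : ℝ) 1) :
    DifferentiableAt ℂ stripSigmoid w := by
  refine (hasDerivAt_complex_logistic (Ioo_subset_Icc_self hw)).differentiableAt.congr_of_eventuallyEq
    ?_
  have : ∀ᶠ z : ℂ in 𝓝 w, z.im ∈ Ioo (-1 : ℝ) 1 :=
    Complex.continuous_im.continuousAt.eventually (isOpen_Ioo.mem_nhds hw)
  filter_upwards [this] with z hz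
  have : (⟨z.re, max (-1) (min 1 z.im)⟩ : ℂ) = z := by
    apply Complex.ext
    · rfl
    · simp [min_eq_right hz.2.le, max_eq_right hz.1.le]
  rw [stripSigmoid, this]

/-! ### The logistic equation and its time-`T` map -/

/-- The right-hand side `α + (β - α) σ(s + ℓ)`, with `σ` the logistic function. -/
noncomputable def logisticField (α β l : ℝ → ℝ) (t s : ℝ) : ℝ :=
  α t + (β t - α t) * Real.sigmoid (s + l t)

/-- A globally Lipschitz complex extension of `logisticField`, holomorphic near the real axis. -/
noncomputable def complexLogisticField (α β l : ℝ → ℝ) (t : ℝ) (w : ℂ) : ℂ :=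
  α t + (β t - α t) * stripSigmoid (w + l t)

section

variable {α β l : ℝ → ℝ} {M : ℝ≥0}

theorem complexLogisticField_ofReal (t s : ℝ) :
    complexLogisticField α β l t s = (logisticField α β l t s : ℝ) := by
  rw [complexLogisticField, logisticField, ← Complex.ofReal_add, stripSigmoid_ofReal]
  push_cast
  rfl

theorem norm_complex_sub_le (hα : ∀ t, |α t| ≤ M) (hβ : ∀ t, |β t| ≤ M) (t : ℝ) :
    ‖(β t - α t : ℂ)‖ ≤ 2 * M := by
  rw [← Complex.ofReal_sub, Complex.norm_real, Real.norm_eq_abs]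
  linarith [abs_sub (β t) (α t), hα t, hβ t]

theorem lipschitzWith_complexLogisticField (hα : ∀ t, |α t| ≤ M) (hβ : ∀ t, |β t| ≤ M) (t : ℝ) :
    LipschitzWith (8 * M) (complexLogisticField α β l t) := by
  refine LipschitzWith.of_dist_le_mul fun a b => ?_
  have h1 := lipschitzWith_stripSigmoid.dist_le_mul (a + l t) (b + l t)
  have h2 := norm_complex_sub_le hα hβ t
  rw [complexLogisticField, complexLogisticField, dist_add_left, dist_eq_norm, ← mul_sub, norm_mul]
  rw [dist_add_right, dist_eq_norm] at h1
  calc _ ≤ (2 * M : ℝ) * ((4 : ℝ≥0) * dist a b) := by gcongr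
    _ = _ := by push_cast; ring

theorem norm_complexLogisticField_le (hα : ∀ t, |α t| ≤ M) (hβ : ∀ t, |β t| ≤ M) (t : ℝ) (w : ℂ) :
    ‖complexLogisticField α β l t w‖ ≤ (3 * M : ℝ≥0) := by
  have h1 := norm_stripSigmoid_le (w + l t)
  have h2 := norm_complex_sub_le hα hβ t
  have h3 : ‖(α t : ℂ)‖ ≤ M := by
    rw [Complex.norm_real]; exact hα t
  calc _ ≤ ‖(α t : ℂ)‖ + ‖(β t - α t : ℂ)‖ * ‖stripSigmoid (w + l t)‖ := by
        rw [← norm_mul]; exact norm_add_le _ _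
    _ ≤ M + 2 * M * 1 := by gcongr
    _ = _ := by push_cast; ring

theorem lipschitzWith_logisticField (hα : ∀ t, |α t| ≤ M) (hβ : ∀ t, |β t| ≤ M) (t : ℝ) :
    LipschitzWith (8 * M) (logisticField α β l t) := by
  refine LipschitzWith.of_dist_le_mul fun a b => ?_
  have := (lipschitzWith_complexLogisticField (l := l) hα hβ t).dist_le_mul a b
  rwa [complexLogisticField_ofReal, complexLogisticField_ofReal, Complex.dist_of_im_eq (by simp),
    Complex.dist_of_im_eq (by simp)] at this

theorem abs_logisticField_le (hα : ∀ t, |α t| ≤ M) (hβ : ∀ t, |β t| ≤ M) (t s : ℝ) :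
    |logisticField α β l t s| ≤ (3 * M : ℝ≥0) := by
  have := norm_complexLogisticField_le (l := l) hα hβ t s
  rwa [complexLogisticField_ofReal, Complex.norm_real] at this

theorem continuous_complexLogisticField (hα : Continuous α) (hβ : Continuous β) (hl : Continuous l)
    (w : ℂ) : Continuous (complexLogisticField α β l · w) := by
  have := lipschitzWith_stripSigmoid.continuous
  unfold complexLogisticField
  fun_prop

theorem continuous_logisticField (hα : Continuous α) (hβ : Continuous β) (hl : Continuous l)
    (s : ℝ) : Continuous (logisticField α β l · s) := by
  have := continuous_sigmoid
  unfold logisticField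
  fun_prop

/-- The time-`T` map of the logistic equation extends holomorphically to a strip around `ℝ`. -/
theorem exists_holomorphic_extension (hαc : Continuous α) (hβc : Continuous β) (hlc : Continuous l)
    (hα : ∀ t, |α t| ≤ M) (hβ : ∀ t, |β t| ≤ M) {Φ : ℝ → ℝ → ℝ} (hΦ0 : ∀ s, Φ s 0 = s)
    (hΦ : ∀ s t, HasDerivAt (Φ s) (logisticField α β l t (Φ s t)) t) {T : ℝ} (hT : 0 ≤ T) :
    ∃ δ > 0, ∃ f : ℂ → ℂ, (∀ s : ℝ, f s = Φ s T) ∧ ∀ z : ℂ, |z.im| < δ → DifferentiableAt ℂ f z := by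
  have hL := lipschitzWith_complexLogisticField (l := l) hα hβ
  have hc := continuous_complexLogisticField hαc hβc hlc
  choose W hW0 hW using fun z => exists_global_solution hc hL
    (norm_complexLogisticField_le (l := l) hα hβ) 0 z
  have hreal : ∀ s : ℝ, ∀ t, W s t = Φ s t := by
    intro s t
    have : W s = fun t => (Φ s t : ℂ) := by
      refine solution_unique hL (hW s) (fun t => ?_) (t₀ := 0) (by rw [hW0, hΦ0])
      rw [complexLogisticField_ofReal]
      exact (hΦ s t).ofReal_comp
    rw [this]
  -- By Gronwall, the trajectory of z stays within |Im z| e^{8MT} of the real trajectory of Re z.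
  -- This width thus keeps it in |Im| < 1, where the extended field is holomorphic.
  refine ⟨Real.exp (-((8 * M : ℝ≥0) * T)), Real.exp_pos _, fun z => W z T, fun s => hreal s T,
    fun z hz => differentiableAt_flow hc hL hW0 hW hT fun t ht => ?_⟩
  have him : |(W z t).im| < 1 := by
    have h1 := dist_solution_le hL (hW z) (hW z.re) ht.1
    rw [hW0, hW0, hreal] at h1
    have h2 : |(W z t).im| ≤ dist (W z t) (Φ z.re t) := by
      simpa [dist_eq_norm] using Complex.abs_im_le_norm (W z t - Φ z.re t)
    have h3 : dist z z.re = |z.im| := by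
      rw [Complex.dist_of_re_eq (by simp)]; simp
    rw [h3] at h1
    have h4 : Real.exp ((8 * M : ℝ≥0) * (t - 0)) ≤ Real.exp ((8 * M : ℝ≥0) * T) := by
      have := ht.2
      rw [sub_zero]; gcongr
    calc |(W z t).im| ≤ |z.im| * Real.exp ((8 * M : ℝ≥0) * T) :=
          (h2.trans h1).trans (by gcongr)
      _ < Real.exp (-((8 * M : ℝ≥0) * T)) * Real.exp ((8 * M : ℝ≥0) * T) := by gcongr
      _ = 1 := by rw [← Real.exp_add]; simp
  have : DifferentiableAt ℂ (fun w => (α t + (β t - α t) * stripSigmoid (w + l t) : ℂ)) (W z t) := by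
    have h1 : DifferentiableAt ℂ (fun w => stripSigmoid (w + l t)) (W z t) := by
      refine DifferentiableAt.comp (W z t) (g := stripSigmoid)
        (differentiableAt_stripSigmoid (by simpa [abs_lt] using him)) (by fun_prop)
    exact (h1.const_mul _).const_add _
  exact this

/-- A trajectory moves by at most 3MT, uniformly in s. So as s → ±∞ the whole trajectory goes to ±∞,
where σ tends to 0 or 1, and dominated convergence applies. -/
theorem tendsto_displacement (hαc : Continuous α) (hβc : Continuous β) (hlc : Continuous l)
    (hα : ∀ t, |α t| ≤ M) (hβ : ∀ t, |β t| ≤ M) {Φ : ℝ → ℝ → ℝ} (hΦ0 : ∀ s, Φ s 0 = s)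
    (hΦ : ∀ s t, HasDerivAt (Φ s) (logisticField α β l t (Φ s t)) t) {T : ℝ} (hT : 0 ≤ T) :
    Tendsto (fun s => Φ s T - s) atBot (𝓝 (∫ t in (0 : ℝ)..T, α t)) ∧
    Tendsto (fun s => Φ s T - s) atTop (𝓝 (∫ t in (0 : ℝ)..T, β t)) := by
  have hL := lipschitzWith_logisticField (l := l) hα hβ
  have hFc : Continuous (Function.uncurry (logisticField α β l)) :=
    continuous_prod_of_continuous_lipschitzWith' _ _ hL (continuous_logisticField hαc hβc hlc)
  have hΦc : ∀ s, Continuous (Φ s) := fun s =>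
    continuous_iff_continuousAt.2 fun t => (hΦ s t).continuousAt
  have hFΦ : ∀ s, Continuous fun t => logisticField α β l t (Φ s t) := fun s =>
    hFc.comp (continuous_id.prodMk (hΦc s))
  have hdisp : ∀ s, Φ s T - s = ∫ t in (0 : ℝ)..T, logisticField α β l t (Φ s t) := by
    intro s
    rw [intervalIntegral.integral_eq_sub_of_hasDerivAt (fun t _ => hΦ s t)
      ((hFΦ s).intervalIntegrable _ _), hΦ0]
  have hdist : ∀ s, ∀ t ∈ Icc 0 T, |Φ s t - s| ≤ (3 * M : ℝ≥0) * T := by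
    intro s t ht
    have := (convex_Icc 0 T).norm_image_sub_le_of_norm_hasDerivWithin_le
      (fun t _ => (hΦ s t).hasDerivWithinAt)
      (fun t _ => abs_logisticField_le (l := l) hα hβ t (Φ s t)) (left_mem_Icc.2 hT) ht
    rw [hΦ0, Real.norm_eq_abs, Real.norm_eq_abs, sub_zero, abs_of_nonneg ht.1] at this
    exact this.trans (by have := ht.2; gcongr)
  simp_rw [hdisp]
  have hmain : ∀ (L : Filter ℝ) [L.IsCountablyGenerated] (v : ℝ → ℝ),
      (∀ t ∈ Icc 0 T, Tendsto (fun s => logisticField α β l t (Φ s t)) L (𝓝 (v t))) →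
      Tendsto (fun s => ∫ t in (0 : ℝ)..T, logisticField α β l t (Φ s t)) L
        (𝓝 (∫ t in (0 : ℝ)..T, v t)) := by
    intro L _ v hv
    refine intervalIntegral.tendsto_integral_filter_of_dominated_convergence
      (fun _ => ((3 * M : ℝ≥0) : ℝ))
      (Eventually.of_forall fun s => (hFΦ s).aestronglyMeasurable)
      (Eventually.of_forall fun s => Eventually.of_forall fun t _ =>
        abs_logisticField_le hα hβ t (Φ s t))
      intervalIntegrable_const (Eventually.of_forall fun t ht => hv t ?_)
    rw [uIoc_of_le hT] at ht
    exact Ioc_subset_Icc_self ht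
  constructor
  · refine hmain atBot α fun t ht => ?_
    have h1 : Tendsto (fun s => Φ s t + l t) atBot atBot := by
      refine tendsto_atBot_mono (fun s => ?_)
        (tendsto_atBot_add_const_right _ ((3 * M : ℝ≥0) * T + l t) tendsto_id)
      have := (abs_le.1 (hdist s t ht)).2
      simp only [id]
      linarith
    simpa [logisticField] using
      ((Real.tendsto_sigmoid_atBot.comp h1).const_mul (β t - α t)).const_add (α t)
  · refine hmain atTop β fun t ht => ?_
    have h1 : Tendsto (fun s => Φ s t + l t) atTop atTop := by
      refine tendsto_atTop_mono (fun s => ?_)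
        (tendsto_atTop_add_const_right _ (-((3 * M : ℝ≥0) * T) + l t) tendsto_id)
      have := (abs_le.1 (hdist s t ht)).1
      simp only [id]
      linarith
    simpa [logisticField] using
      ((Real.tendsto_sigmoid_atTop.comp h1).const_mul (β t - α t)).const_add (α t)

/-- If the averages of `α` and `β` have opposite signs, then the time-`T` map of the logistic
equation has an isolated fixed point. -/
theorem exists_isolated_fixedPoint (hαc : Continuous α) (hβc : Continuous β) (hlc : Continuous l)
    (hα : ∀ t, |α t| ≤ M) (hβ : ∀ t, |β t| ≤ M) {Φ : ℝ → ℝ → ℝ} (hΦ0 : ∀ s, Φ s 0 = s)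
    (hΦ : ∀ s t, HasDerivAt (Φ s) (logisticField α β l t (Φ s t)) t) {T : ℝ} (hT : 0 ≤ T)
    (hint : (∫ t in (0 : ℝ)..T, α t) * (∫ t in (0 : ℝ)..T, β t) < 0) :
    ∃ s₀, Φ s₀ T = s₀ ∧ ∃ ε > 0, ∀ s, |s - s₀| < ε → Φ s T = s → s = s₀ := by
  obtain ⟨hbot, htop⟩ := tendsto_displacement hαc hβc hlc hα hβ hΦ0 hΦ hT
  obtain ⟨δ, hδ, f, hfΦ, hf⟩ := exists_holomorphic_extension hαc hβc hlc hα hβ hΦ0 hΦ hT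
  have hcont : Continuous fun s => Φ s T - s := by
    have : Continuous fun s : ℝ => f s := continuous_iff_continuousAt.2 fun s =>
      ContinuousAt.comp (f := ((↑) : ℝ → ℂ)) (hf s (by simpa using hδ)).continuousAt
        Complex.continuous_ofReal.continuousAt
    have h2 : Continuous fun s : ℝ => (f s).re - s :=
      (Complex.continuous_re.comp this).sub continuous_id
    simpa [hfΦ] using h2
  obtain ⟨s₀, hs₀⟩ : ∃ s₀, Φ s₀ T - s₀ = 0 := by
    rcases mul_neg_iff.1 hint with ⟨h1, h2⟩ | ⟨h1, h2⟩
    · obtain ⟨a, ha⟩ := (hbot.eventually (lt_mem_nhds h1)).exists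
      obtain ⟨b, hb⟩ := (htop.eventually (gt_mem_nhds h2)).exists
      exact mem_range_of_exists_le_of_exists_ge hcont ⟨b, hb.le⟩ ⟨a, ha.le⟩
    · obtain ⟨a, ha⟩ := (hbot.eventually (gt_mem_nhds h1)).exists
      obtain ⟨b, hb⟩ := (htop.eventually (lt_mem_nhds h2)).exists
      exact mem_range_of_exists_le_of_exists_ge hcont ⟨a, ha.le⟩ ⟨b, hb.le⟩
  refine ⟨s₀, sub_eq_zero.1 hs₀, ?_⟩
  by_contra! hcon
  have hopen : IsOpen {z : ℂ | |z.im| < δ} :=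
    isOpen_lt (Complex.continuous_im.abs) continuous_const
  have hconv : Convex ℝ {z : ℂ | |z.im| < δ} := by
    have := (convex_Ioo (-δ) δ).linear_preimage Complex.imLm
    simpa [preimage, abs_lt] using this
  have han : AnalyticOnNhd ℂ (fun z => f z - z) {z : ℂ | |z.im| < δ} :=
    DifferentiableOn.analyticOnNhd
      (fun z hz => ((hf z hz).sub differentiableAt_id).differentiableWithinAt) hopen
  have hfreq : ∃ᶠ z in 𝓝[≠] (s₀ : ℂ), f z - z = 0 := by
    rw [frequently_nhdsWithin_iff, Metric.nhds_basis_ball.frequently_iff]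
    intro ε hε
    obtain ⟨s, hs, hsT, hne⟩ := hcon ε hε
    refine ⟨s, ?_, by rw [hfΦ, hsT, sub_self], by simpa using hne⟩
    rw [Metric.mem_ball, Complex.dist_of_im_eq (by simp)]
    simpa [Real.dist_eq] using hs
  have hzero := han.eqOn_zero_of_preconnected_of_frequently_eq_zero hconv.isPreconnected
    (by simpa using hδ) hfreq
  have hD : ∀ s : ℝ, Φ s T - s = 0 := by
    intro s
    have := hzero (show (s : ℂ) ∈ {z : ℂ | |z.im| < δ} by simpa using hδ)
    simp only [hfΦ, Pi.zero_apply] at this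
    exact_mod_cast this
  -- An identically zero displacement would make its limit ∫α at -∞ vanish, contrary to `hint`.
  simp only [hD] at hbot
  rw [tendsto_nhds_unique hbot tendsto_const_nhds, zero_mul] at hint
  exact lt_irrefl _ hint

end

/-! ### Quasi-polar coordinates -/

/-- Quasi-polar coordinates `(u, θ) ↦ (e^{pu} cos θ, e^{qu} sin θ)` on the punctured plane. -/
noncomputable def quasiPolar (p q : ℕ) (w : ℝ × ℝ) : ℝ × ℝ :=
  (Real.exp (p * w.1) * Real.cos w.2, Real.exp (q * w.1) * Real.sin w.2)

section QuasiPolar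

variable {p q : ℕ}

theorem quasiPolar_ne_zero (w : ℝ × ℝ) : quasiPolar p q w ≠ 0 := by
  intro h
  have h1 : Real.cos w.2 = 0 := by
    simpa [quasiPolar, (Real.exp_pos _).ne'] using congrArg Prod.fst h
  have h2 : Real.sin w.2 = 0 := by
    simpa [quasiPolar, (Real.exp_pos _).ne'] using congrArg Prod.snd h
  have := Real.sin_sq_add_cos_sq w.2
  simp [h1, h2] at this

theorem quasiPolar_add_two_pi (u θ : ℝ) :
    quasiPolar p q (u, θ + 2 * Real.pi) = quasiPolar p q (u, θ) := by
  simp [quasiPolar]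

/-- If u < v, equality of the points forces |cos θ| ≥ |cos η| and |sin θ| ≥ |sin η|, one of them
strictly, against cos² + sin² = 1. So u = v, and the angles agree modulo 2π. -/
theorem quasiPolar_inj (hp : 1 ≤ p) (hq : 1 ≤ q) {u v θ η : ℝ}
    (h : quasiPolar p q (u, θ) = quasiPolar p q (v, η)) :
    u = v ∧ ∃ k : ℤ, θ = η + k * (2 * Real.pi) := by
  have hp' : (1 : ℝ) ≤ p := by exact_mod_cast hp
  have hq' : (1 : ℝ) ≤ q := by exact_mod_cast hq
  have hnlt : ∀ u v θ η : ℝ, quasiPolar p q (u, θ) = quasiPolar p q (v, η) → ¬ u < v := by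
    intro u v θ η h huv
    have h1 : Real.exp (p * u) * Real.cos θ = Real.exp (p * v) * Real.cos η := congrArg Prod.fst h
    have h2 : Real.exp (q * u) * Real.sin θ = Real.exp (q * v) * Real.sin η := congrArg Prod.snd h
    have e1 : Real.exp (p * u) < Real.exp (p * v) := by gcongr
    have e2 : Real.exp (q * u) < Real.exp (q * v) := by gcongr
    have c1 : Real.cos η ^ 2 ≤ Real.cos θ ^ 2 ∧ (Real.cos η ≠ 0 → Real.cos η ^ 2 < Real.cos θ ^ 2) := by
      have : Real.cos θ = Real.exp (p * v) / Real.exp (p * u) * Real.cos η := by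
        field_simp; linarith
      have hr : 1 < Real.exp (p * v) / Real.exp (p * u) := (one_lt_div (Real.exp_pos _)).2 e1
      have hr2 := one_lt_pow₀ hr two_ne_zero
      rw [this, mul_pow]
      refine ⟨by nlinarith [sq_nonneg (Real.cos η)], fun hne => ?_⟩
      have := pow_pos (abs_pos.2 hne) 2
      rw [sq_abs] at this
      nlinarith
    have c2 : Real.sin η ^ 2 ≤ Real.sin θ ^ 2 ∧ (Real.sin η ≠ 0 → Real.sin η ^ 2 < Real.sin θ ^ 2) := by
      have : Real.sin θ = Real.exp (q * v) / Real.exp (q * u) * Real.sin η := by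
        field_simp; linarith
      have hr : 1 < Real.exp (q * v) / Real.exp (q * u) := (one_lt_div (Real.exp_pos _)).2 e2
      have hr2 := one_lt_pow₀ hr two_ne_zero
      rw [this, mul_pow]
      refine ⟨by nlinarith [sq_nonneg (Real.sin η)], fun hne => ?_⟩
      have := pow_pos (abs_pos.2 hne) 2
      rw [sq_abs] at this
      nlinarith
    have t1 := Real.sin_sq_add_cos_sq θ
    have t2 := Real.sin_sq_add_cos_sq η
    by_cases hc : Real.cos η = 0
    · by_cases hs : Real.sin η = 0
      · simp [hc, hs] at t2
      · linarith [c1.1, c2.2 hs]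
    · linarith [c1.2 hc, c2.1]
  have huv : u = v := le_antisymm (not_lt.1 <| hnlt v u η θ h.symm) (not_lt.1 <| hnlt u v θ η h)
  subst huv
  have h1 : Real.cos θ = Real.cos η := mul_left_cancel₀ (Real.exp_pos _).ne' (congrArg Prod.fst h)
  have h2 : Real.sin θ = Real.sin η := mul_left_cancel₀ (Real.exp_pos _).ne' (congrArg Prod.snd h)
  obtain ⟨k, hk⟩ := Real.Angle.angle_eq_iff_two_pi_dvd_sub.1 (Real.Angle.cos_sin_inj h1 h2)
  exact ⟨rfl, k, by linarith⟩

theorem exists_quasiPolar_eq (hp : 1 ≤ p) (hq : 1 ≤ q) {z : ℝ × ℝ} (hz : z ≠ 0) :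
    ∃ u, ∃ θ ∈ Ioc (-Real.pi) Real.pi, quasiPolar p q (u, θ) = z := by
  have hp' : (0 : ℝ) < p := by exact_mod_cast hp
  have hq' : (0 : ℝ) < q := by exact_mod_cast hq
  obtain ⟨x, y⟩ := z
  -- g decreases from +∞ to 0; where g(u) = 1 the rescaled point (x e^{-pu}, y e^{-qu}) lies on the
  -- unit circle and its argument is the angle.
  set g : ℝ → ℝ := fun u => x ^ 2 * Real.exp (-(2 * p * u)) + y ^ 2 * Real.exp (-(2 * q * u)) with hg
  have hgc : Continuous g := by fun_prop
  have htop : ∀ r : ℝ, 0 < r → Tendsto (fun u : ℝ => -(2 * r * u)) atTop atBot := fun r hr =>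
    tendsto_neg_atTop_atBot.comp (tendsto_id.const_mul_atTop (by positivity))
  have hbot : ∀ r : ℝ, 0 < r → Tendsto (fun u : ℝ => -(2 * r * u)) atBot atTop := fun r hr =>
    tendsto_neg_atBot_atTop.comp (tendsto_id.const_mul_atBot (by positivity))
  have hg0 : Tendsto g atTop (𝓝 0) := by
    simpa using ((Real.tendsto_exp_atBot.comp (htop p hp')).const_mul (x ^ 2)).add
      ((Real.tendsto_exp_atBot.comp (htop q hq')).const_mul (y ^ 2))
  have hg1 : Tendsto g atBot atTop := by
    by_cases hx : x = 0
    · have hy : y ≠ 0 := by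
        rintro rfl; exact hz (by rw [hx]; rfl)
      refine tendsto_atTop_mono (fun u => ?_)
        ((Real.tendsto_exp_atTop.comp (hbot q hq')).const_mul_atTop (show 0 < y ^ 2 by positivity))
      have : 0 ≤ x ^ 2 * Real.exp (-(2 * p * u)) := by positivity
      simp only [hg, Function.comp]; linarith
    · refine tendsto_atTop_mono (fun u => ?_)
        ((Real.tendsto_exp_atTop.comp (hbot p hp')).const_mul_atTop (show 0 < x ^ 2 by positivity))
      have : 0 ≤ y ^ 2 * Real.exp (-(2 * q * u)) := by positivity
      simp only [hg, Function.comp]; linarith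
  obtain ⟨a, ha⟩ := (hg0.eventually (gt_mem_nhds one_pos)).exists
  obtain ⟨b, hb⟩ := (hg1.eventually_ge_atTop 1).exists
  obtain ⟨u, hu⟩ := mem_range_of_exists_le_of_exists_ge hgc ⟨a, ha.le⟩ ⟨b, hb⟩
  set w : ℂ := ⟨x * Real.exp (-(p * u)), y * Real.exp (-(q * u))⟩ with hw
  have hw1 : ‖w‖ = 1 := by
    rw [Complex.norm_def, Complex.normSq_mk, Real.sqrt_eq_one, ← hu, hg]
    have e : ∀ r : ℝ, Real.exp (-(2 * r * u)) = Real.exp (-(r * u)) * Real.exp (-(r * u)) := fun r => by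
      rw [← Real.exp_add]; ring_nf
    simp only [e]
    ring
  have hw0 : w ≠ 0 := by rw [← norm_pos_iff, hw1]; exact one_pos
  refine ⟨u, w.arg, Complex.arg_mem_Ioc w, ?_⟩
  rw [quasiPolar, Complex.cos_arg hw0, Complex.sin_arg, hw1]
  refine Prod.ext ?_ ?_
  · simp only [hw, div_one]
    rw [mul_left_comm, ← Real.exp_add]; simp
  · simp only [hw, div_one]
    rw [mul_left_comm, ← Real.exp_add]; simp

theorem weight_pos (hp : 1 ≤ p) (hq : 1 ≤ q) (θ : ℝ) :
    0 < (p : ℝ) * Real.cos θ ^ 2 + q * Real.sin θ ^ 2 := by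
  have hp' : (1 : ℝ) ≤ p := by exact_mod_cast hp
  have hq' : (1 : ℝ) ≤ q := by exact_mod_cast hq
  nlinarith [Real.sin_sq_add_cos_sq θ, sq_nonneg (Real.sin θ), sq_nonneg (Real.cos θ)]

/-- The Jacobian is e^{(p+q)u}(p cos²θ + q sin²θ), which is positive by `weight_pos`; the preimage
(A, B) comes from Cramer's rule. -/
theorem isOpenMap_quasiPolar (hp : 1 ≤ p) (hq : 1 ≤ q) : IsOpenMap (quasiPolar p q) := by
  refine isOpenMap_iff_nhds_le.2 fun w => ?_
  have hsmooth : ContDiff ℝ 1 (quasiPolar p q) := by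
    unfold quasiPolar; fun_prop
  have hs := hsmooth.contDiffAt.hasStrictFDerivAt (x := w) one_ne_zero
  refine (hs.map_nhds_eq_of_surj ?_).ge
  rw [LinearMap.range_eq_top]
  rintro ⟨a, b⟩
  set d := (p : ℝ) * Real.cos w.2 ^ 2 + q * Real.sin w.2 ^ 2 with hd
  have hd0 : d ≠ 0 := (weight_pos hp hq _).ne'
  set A := (Real.cos w.2 * (a * Real.exp (-(p * w.1))) + Real.sin w.2 * (b * Real.exp (-(q * w.1)))) / d
  set B := (p * Real.cos w.2 * (b * Real.exp (-(q * w.1))) -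
    q * Real.sin w.2 * (a * Real.exp (-(p * w.1)))) / d
  refine ⟨(A, B), ?_⟩
  have hline : HasDerivAt (fun t : ℝ => w + t • (A, B)) (A, B) 0 := by
    simpa using ((hasDerivAt_id (0 : ℝ)).smul_const (A, B)).const_add w
  have h1 : HasDerivAt (fun t : ℝ => quasiPolar p q (w + t • (A, B)))
      (fderiv ℝ (quasiPolar p q) w (A, B)) 0 := by
    refine HasFDerivAt.comp_hasDerivAt (0 : ℝ) (l := quasiPolar p q) ?_ hline
    simpa using hs.hasFDerivAt
  have hl1 : HasDerivAt (fun t : ℝ => w.1 + t * A) A 0 := by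
    simpa using ((hasDerivAt_id (0 : ℝ)).mul_const A).const_add w.1
  have hl2 : HasDerivAt (fun t : ℝ => w.2 + t * B) B 0 := by
    simpa using ((hasDerivAt_id (0 : ℝ)).mul_const B).const_add w.2
  have h2 := ((hl1.const_mul (p : ℝ)).exp.mul hl2.cos).prodMk ((hl1.const_mul (q : ℝ)).exp.mul hl2.sin)
  refine (h1.unique h2).trans ?_
  have ep : Real.exp (p * w.1) * Real.exp (-(p * w.1)) = 1 := by rw [← Real.exp_add]; simp
  have eq : Real.exp (q * w.1) * Real.exp (-(q * w.1)) = 1 := by rw [← Real.exp_add]; simp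
  refine Prod.ext ?_ ?_
  · simp only [zero_mul, add_zero]
    have : p * A * Real.cos w.2 - B * Real.sin w.2 = a * Real.exp (-(p * w.1)) := by
      simp only [A, B]; field_simp; rw [hd]; ring
    linear_combination Real.exp (p * w.1) * this + a * ep
  · simp only [zero_mul, add_zero]
    have : q * A * Real.sin w.2 + B * Real.cos w.2 = b * Real.exp (-(q * w.1)) := by
      simp only [A, B]; field_simp; rw [hd]; ring
    linear_combination Real.exp (q * w.1) * this + b * eq

/-! ### Closed curves that are graphs over the angle -/

/-- The closed curve `u = v(θ)` in quasi-polar coordinates. -/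
def starCurve (p q : ℕ) (v : ℝ → ℝ) : Set (ℝ × ℝ) := range fun θ => quasiPolar p q (v θ, θ)

variable {v : ℝ → ℝ}

theorem eq_and_apply_eq_of_quasiPolar_eq (hp : 1 ≤ p) (hq : 1 ≤ q)
    (hv : Function.Periodic v (2 * Real.pi)) {u u' θ θ' : ℝ}
    (h : quasiPolar p q (u, θ) = quasiPolar p q (u', θ')) : u = u' ∧ v θ = v θ' := by
  obtain ⟨h1, k, hk⟩ := quasiPolar_inj hp hq h
  exact ⟨h1, by rw [hk]; exact (hv.int_mul k) θ'⟩

theorem quasiPolar_mem_starCurve (hp : 1 ≤ p) (hq : 1 ≤ q)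
    (hv : Function.Periodic v (2 * Real.pi)) {u θ : ℝ} :
    quasiPolar p q (u, θ) ∈ starCurve p q v ↔ u = v θ := by
  constructor
  · rintro ⟨η, hη⟩
    obtain ⟨h1, h2⟩ := eq_and_apply_eq_of_quasiPolar_eq hp hq hv hη
    rw [← h1, h2]
  · rintro rfl
    exact ⟨θ, rfl⟩

theorem Function.Periodic.exists_abs_le (hvc : Continuous v) {T : ℝ} (hT : T ≠ 0)
    (hv : Function.Periodic v T) : ∃ C : ℝ≥0, ∀ θ, |v θ| ≤ C := by
  obtain ⟨C, hC⟩ := (hv.compact_of_continuous hT hvc).isBounded.exists_norm_le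
  refine ⟨C.toNNReal, fun θ => (hC (v θ) ⟨θ, rfl⟩).trans (Real.le_coe_toNNReal C)⟩

/-- The points below the graph together with 0, and the points above it, are disjoint open sets
covering the complement. The component of 0 therefore lies in the first, which is bounded. -/
theorem surroundsOrigin_starCurve (hp : 1 ≤ p) (hq : 1 ≤ q) (hvc : Continuous v)
    (hv : Function.Periodic v (2 * Real.pi)) : SurroundsOrigin (starCurve p q v) := by
  have h0 : (0 : ℝ × ℝ) ∉ starCurve p q v := by
    rintro ⟨θ, hθ⟩
    exact quasiPolar_ne_zero _ hθ
  obtain ⟨C, hC⟩ := hv.exists_abs_le hvc Real.two_pi_pos.ne'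
  set inner : Set (ℝ × ℝ) := insert 0 (quasiPolar p q '' {w | w.1 < v w.2}) with hinner
  set outer : Set (ℝ × ℝ) := quasiPolar p q '' {w | v w.2 < w.1} with houter
  have hopen : IsOpenMap (quasiPolar p q) := isOpenMap_quasiPolar hp hq
  have hi' : IsOpen (quasiPolar p q '' {w | w.1 < v w.2}) :=
    hopen _ (isOpen_lt continuous_fst (hvc.comp continuous_snd))
  have ho : IsOpen outer := hopen _ (isOpen_lt (hvc.comp continuous_snd) continuous_fst)
  have hdisj : Disjoint inner outer := by
    rw [Set.disjoint_left]
    rintro z (rfl | ⟨w, hw, rfl⟩) ⟨w', hw', h⟩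
    · exact quasiPolar_ne_zero _ h
    · obtain ⟨h1, h2⟩ := eq_and_apply_eq_of_quasiPolar_eq hp hq hv (show
        quasiPolar p q (w'.1, w'.2) = quasiPolar p q (w.1, w.2) from h)
      simp only [mem_ofPred_eq] at hw hw'
      linarith
  have hnhds : inner ∈ 𝓝 (0 : ℝ × ℝ) := by
    set r : ℝ := Real.exp (-(p * C)) ^ 2 with hr
    set r' : ℝ := Real.exp (-(q * C)) ^ 2 with hr'
    -- Inside this ellipse u < -C, which is below the graph.
    have : ∀ᶠ z : ℝ × ℝ in 𝓝 0, z.1 ^ 2 / r + z.2 ^ 2 / r' < 1 := by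
      have hc : Continuous fun z : ℝ × ℝ => z.1 ^ 2 / r + z.2 ^ 2 / r' := by fun_prop
      exact hc.continuousAt.eventually (gt_mem_nhds (by simp))
    filter_upwards [this] with z hz
    by_cases hz0 : z = 0
    · exact Or.inl hz0
    obtain ⟨u, θ, -, rfl⟩ := exists_quasiPolar_eq hp hq hz0
    refine Or.inr ⟨(u, θ), ?_, rfl⟩
    simp only [mem_ofPred_eq]
    by_contra! hcon
    have hu : -(C : ℝ) ≤ u := by linarith [(abs_le.1 (hC θ)).1]
    have e1 : Real.exp (-(p * C)) ≤ Real.exp (p * u) := by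
      rw [← mul_neg]; gcongr
    have e2 : Real.exp (-(q * C)) ≤ Real.exp (q * u) := by
      rw [← mul_neg]; gcongr
    have h1 : Real.cos θ ^ 2 ≤ (Real.exp (p * u) * Real.cos θ) ^ 2 / r := by
      rw [le_div_iff₀ (by positivity), mul_pow, mul_comm, hr]
      gcongr
    have h2 : Real.sin θ ^ 2 ≤ (Real.exp (q * u) * Real.sin θ) ^ 2 / r' := by
      rw [le_div_iff₀ (by positivity), mul_pow, mul_comm, hr']
      gcongr
    have := Real.sin_sq_add_cos_sq θ
    simp only [quasiPolar] at hz
    linarith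
  have hi : IsOpen inner := by
    rw [isOpen_iff_mem_nhds]
    rintro z (rfl | hz)
    · exact hnhds
    · exact mem_of_superset (hi'.mem_nhds hz) (subset_insert _ _)
  have hcover : (starCurve p q v)ᶜ ⊆ inner ∪ outer := by
    intro z hz
    by_cases hz0 : z = 0
    · exact Or.inl (Or.inl hz0)
    obtain ⟨u, θ, -, rfl⟩ := exists_quasiPolar_eq hp hq hz0
    have hne : u ≠ v θ := fun h => hz ((quasiPolar_mem_starCurve hp hq hv).2 h)
    rcases lt_or_gt_of_ne hne with h | h
    · exact Or.inl (Or.inr ⟨(u, θ), h, rfl⟩)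
    · exact Or.inr ⟨(u, θ), h, rfl⟩
  have hsub : connectedComponentIn (starCurve p q v)ᶜ 0 ⊆ inner :=
    isPreconnected_connectedComponentIn.subset_left_of_subset_union hi ho hdisj
      ((connectedComponentIn_subset _ _).trans hcover)
      ⟨0, mem_connectedComponentIn h0, Or.inl rfl⟩
  refine ⟨h0, Bornology.IsBounded.subset ?_ hsub⟩
  rw [hinner, Bornology.isBounded_insert]
  refine isBounded_iff_forall_norm_le.2 ⟨max (Real.exp (p * C)) (Real.exp (q * C)), ?_⟩
  rintro _ ⟨⟨u, θ⟩, hw, rfl⟩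
  simp only [mem_ofPred_eq] at hw
  have hu : u ≤ C := hw.le.trans ((le_abs_self _).trans (hC θ))
  rw [Prod.norm_def]
  simp only [quasiPolar, Real.norm_eq_abs, abs_mul, Real.abs_exp]
  refine max_le_max ?_ ?_
  · calc _ ≤ Real.exp (p * C) * 1 := by
          gcongr
          exact Real.abs_cos_le_one θ
      _ = _ := mul_one _
  · calc _ ≤ Real.exp (q * C) * 1 := by
          gcongr
          exact Real.abs_sin_le_one θ
      _ = _ := mul_one _

end QuasiPolar

/-! ### Comparison, uniqueness along curves and time change -/

/-- Ordered initial values give ordered solutions. -/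
theorem solution_lt {F : ℝ → ℝ → ℝ} {K : ℝ≥0} (hL : ∀ t, LipschitzWith K (F t)) {f g : ℝ → ℝ}
    (hf : ∀ t, HasDerivAt f (F t (f t)) t) (hg : ∀ t, HasDerivAt g (F t (g t)) t) {a : ℝ}
    (h : f a < g a) (t : ℝ) : f t < g t := by
  by_contra! hcon
  have hc : Continuous fun t => g t - f t :=
    continuous_iff_continuousAt.2 fun t => (hg t).continuousAt.sub (hf t).continuousAt
  obtain ⟨b, hb⟩ := mem_range_of_exists_le_of_exists_ge hc ⟨t, sub_nonpos.2 hcon⟩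
    ⟨a, (sub_pos.2 h).le⟩
  have := solution_unique hL hf hg (t₀ := b) (sub_eq_zero.1 hb).symm
  rw [this] at h
  exact lt_irrefl _ h

/-- A solution `γ` of `γ' = X(γ)` follows every reparametrised solution that it meets. -/
theorem solution_comp_eq {X : ℝ × ℝ → ℝ × ℝ} (hX : ContDiffOn ℝ 1 X {0}ᶜ) {γ c : ℝ → ℝ × ℝ}
    {τ k : ℝ → ℝ} (hγ : ∀ t, HasDerivAt γ (X (γ t)) t) (hc : ∀ θ, HasDerivAt c (k θ • X (c θ)) θ)
    (hc0 : ∀ θ, c θ ≠ 0) (hk : Continuous k) (hτ : ∀ θ, HasDerivAt τ (k θ) θ) {θ₀ : ℝ}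
    (h : γ (τ θ₀) = c θ₀) (θ : ℝ) : γ (τ θ) = c θ := by
  have hγτ : ∀ θ, HasDerivAt (fun θ => γ (τ θ)) (k θ • X (γ (τ θ))) θ := fun θ =>
    (hγ (τ θ)).scomp θ (hτ θ)
  have hcγ : Continuous fun θ => γ (τ θ) :=
    continuous_iff_continuousAt.2 fun t => (hγτ t).continuousAt
  have hcc : Continuous c := continuous_iff_continuousAt.2 fun t => (hc t).continuousAt
  -- Local uniqueness is used at c θ₁ ≠ 0, where X is C¹ and so locally Lipschitz; γ is not assumed
  -- to avoid the origin.
  have hopen : IsOpen {θ | γ (τ θ) = c θ} := by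
    rw [isOpen_iff_mem_nhds]
    intro θ₁ h₁
    obtain ⟨K, s, hs, hL⟩ := (hX.contDiffAt
      (isOpen_compl_singleton.mem_nhds (hc0 θ₁))).exists_lipschitzOnWith
    refine ODE_solution_unique_of_eventually (v := fun θ y => k θ • X y)
      (s := fun _ => s) (K := (‖k θ₁‖₊ + 1) * K) ?_ ?_ ?_ h₁
    · have : ∀ᶠ θ in 𝓝 θ₁, ‖k θ‖₊ < ‖k θ₁‖₊ + 1 :=
        hk.nnnorm.continuousAt.eventually (gt_mem_nhds (by simp))
      filter_upwards [this] with θ hθ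
      refine LipschitzOnWith.of_dist_le_mul fun x hx y hy => ?_
      rw [dist_smul₀]
      have h1 := hL.dist_le_mul x hx y hy
      have h2 : ‖k θ‖ ≤ ((‖k θ₁‖₊ + 1 : ℝ≥0) : ℝ) := by exact_mod_cast hθ.le
      calc _ ≤ ((‖k θ₁‖₊ + 1 : ℝ≥0) : ℝ) * (K * dist x y) := by gcongr
        _ = _ := by push_cast; ring
    · have h₁' : γ (τ θ₁) = c θ₁ := h₁
      filter_upwards [hcγ.continuousAt.eventually_mem (by simpa only [h₁'] using hs)] with θ hθ
      exact ⟨hγτ θ, hθ⟩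
    · filter_upwards [hcc.continuousAt.eventually_mem hs] with θ hθ
      exact ⟨hc θ, hθ⟩
  have huniv := IsClopen.eq_univ ⟨isClosed_eq hcγ hcc, hopen⟩ ⟨θ₀, h⟩
  exact huniv.ge (mem_univ θ)

/-- The time change with positive periodic speed `k`, together with its inverse. -/
theorem exists_time_change {k : ℝ → ℝ} (hk : Continuous k) (hpos : ∀ θ, 0 < k θ) {P : ℝ}
    (hP : 0 < P) (hper : Function.Periodic k P) :
    ∃ (τ φ : ℝ → ℝ) (T : ℝ), 0 < T ∧ (∀ θ, HasDerivAt τ (k θ) θ) ∧ Function.LeftInverse φ τ ∧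
      Function.RightInverse φ τ ∧ (∀ t, HasDerivAt φ (k (φ t))⁻¹ t) ∧ StrictMono φ ∧ φ 0 = 0 ∧
      ∀ t, φ (t + T) = φ t + P := by
  set τ : ℝ → ℝ := fun θ => ∫ x in (0 : ℝ)..θ, k x with hτdef
  have hint : ∀ a b, IntervalIntegrable k MeasureTheory.volume a b := hk.intervalIntegrable
  have hτ : ∀ θ, HasDerivAt τ (k θ) θ := fun θ =>
    intervalIntegral.integral_hasDerivAt_right (hint _ _)
      (hk.stronglyMeasurableAtFilter _ _) hk.continuousAt
  have hτc : Continuous τ := continuous_iff_continuousAt.2 fun t => (hτ t).continuousAt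
  have hmono : StrictMono τ := strictMono_of_deriv_pos fun θ => by rw [(hτ θ).deriv]; exact hpos θ
  have hsurj : Function.Surjective τ := hτc.surjective
    (hper.tendsto_atTop_intervalIntegral_of_pos' (hint _ _) hpos hP)
    (hper.tendsto_atBot_intervalIntegral_of_pos' (hint _ _) hpos hP)
  set e := hmono.orderIsoOfSurjective τ hsurj with he
  have hleft : Function.LeftInverse e.symm τ := fun θ => e.symm_apply_apply θ
  have hright : Function.RightInverse e.symm τ := fun t => e.apply_symm_apply t
  have hT : ∀ θ, τ (θ + P) = τ θ + τ P := by
    intro θ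
    have := hper.intervalIntegral_add_eq_add 0 θ hint
    simpa [hτdef] using this
  refine ⟨τ, e.symm, τ P, ?_, hτ, hleft, hright, fun t => ?_, e.symm.strictMono, ?_, fun t => ?_⟩
  · have h0 : τ 0 = 0 := by simp [hτdef]
    rw [← h0]; exact hmono hP
  · exact HasDerivAt.of_local_left_inverse e.symm.continuous.continuousAt (hτ _) (hpos _).ne'
      (Eventually.of_forall hright)
  · have h0 : τ 0 = 0 := by simp [hτdef]
    conv_lhs => rw [← h0]
    exact hleft 0
  · apply hmono.injective
    rw [hT, hright, hright]

/-! ### The orbit equation in quasi-polar coordinates -/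

section Polar

variable {p q n m : ℕ} {Xn Xm X : ℝ × ℝ → ℝ × ℝ}

theorem continuous_circle (hX : ContDiffOn ℝ 1 X {0}ᶜ) :
    Continuous fun θ : ℝ => X (Real.cos θ, Real.sin θ) := by
  refine hX.continuousOn.comp_continuous (by fun_prop) fun θ h => ?_
  have h1 : Real.cos θ = 0 := congrArg Prod.fst h
  have h2 : Real.sin θ = 0 := congrArg Prod.snd h
  have := Real.sin_sq_add_cos_sq θ
  simp [h1, h2] at this

theorem continuous_aCoeff (hX : ContDiffOn ℝ 1 X {0}ᶜ) : Continuous (aCoeff n m X) := by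
  have h1 := (continuous_circle hX).fst
  have h2 := (continuous_circle hX).snd
  unfold aCoeff
  fun_prop

theorem continuous_bCoeff (hX : ContDiffOn ℝ 1 X {0}ᶜ) : Continuous (bCoeff p q X) := by
  have h1 := (continuous_circle hX).fst
  have h2 := (continuous_circle hX).snd
  unfold bCoeff
  fun_prop

theorem periodic_aCoeff : Function.Periodic (aCoeff n m X) (2 * Real.pi) := fun θ => by
  simp [aCoeff]

theorem periodic_bCoeff : Function.Periodic (bCoeff p q X) (2 * Real.pi) := fun θ => by
  simp [bCoeff]

/-- The equation of the orbits of `Xn + Xm` in the coordinates `((m - n) u, θ)`. -/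
noncomputable def orbitField (p q n m : ℕ) (Xn Xm : ℝ × ℝ → ℝ × ℝ) : ℝ → ℝ → ℝ :=
  logisticField (fun θ => aCoeff n m Xn θ / bCoeff p q Xn θ)
    (fun θ => aCoeff n m Xm θ / bCoeff p q Xm θ)
    (fun θ => Real.log (bCoeff p q Xm θ / bCoeff p q Xn θ))

/-- The curve with quasi-polar coordinates `(S(θ) / (m - n), θ)`. -/
noncomputable def orbitCurve (p q n m : ℕ) (S : ℝ → ℝ) (θ : ℝ) : ℝ × ℝ :=
  quasiPolar p q (S θ / ((m : ℝ) - n), θ)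

/-- The derivative `dt/dθ` of the time along `orbitCurve`. -/
noncomputable def orbitRate (p q n m : ℕ) (Xn Xm : ℝ × ℝ → ℝ × ℝ) (S : ℝ → ℝ) (θ : ℝ) : ℝ :=
  (p * Real.cos θ ^ 2 + q * Real.sin θ ^ 2) * Real.exp (S θ / ((m : ℝ) - n)) /
    (Real.exp (S θ / ((m : ℝ) - n)) ^ n * bCoeff p q Xn θ +
      Real.exp (S θ / ((m : ℝ) - n)) ^ m * bCoeff p q Xm θ)

theorem orbitField_eq (hbn : ∀ θ, 0 < bCoeff p q Xn θ) (hbm : ∀ θ, 0 < bCoeff p q Xm θ)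
    (θ s : ℝ) : orbitField p q n m Xn Xm θ s =
      (aCoeff n m Xn θ + aCoeff n m Xm θ * Real.exp s) /
        (bCoeff p q Xn θ + bCoeff p q Xm θ * Real.exp s) := by
  have h1 := hbn θ
  have h2 := hbm θ
  have h3 := Real.exp_pos s
  have hσ : Real.sigmoid (s + Real.log (bCoeff p q Xm θ / bCoeff p q Xn θ)) =
      bCoeff p q Xm θ * Real.exp s / (bCoeff p q Xn θ + bCoeff p q Xm θ * Real.exp s) := by
    rw [Real.sigmoid_def, Real.exp_neg, Real.exp_add, Real.exp_log (by positivity)]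
    field_simp
    ring
  rw [orbitField, logisticField, hσ]
  field_simp
  ring

theorem orbitRate_pos (hp : 1 ≤ p) (hq : 1 ≤ q) (hbn : ∀ θ, 0 < bCoeff p q Xn θ)
    (hbm : ∀ θ, 0 < bCoeff p q Xm θ) (S : ℝ → ℝ) (θ : ℝ) : 0 < orbitRate p q n m Xn Xm S θ := by
  have h1 := hbn θ
  have h2 := hbm θ
  have := weight_pos hp hq θ
  unfold orbitRate
  positivity

theorem continuous_orbitRate (hXn : ContDiffOn ℝ 1 Xn {0}ᶜ) (hXm : ContDiffOn ℝ 1 Xm {0}ᶜ)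
    (hbn : ∀ θ, 0 < bCoeff p q Xn θ) (hbm : ∀ θ, 0 < bCoeff p q Xm θ) {S : ℝ → ℝ}
    (hS : Continuous S) : Continuous (orbitRate p q n m Xn Xm S) := by
  have h1 : Continuous (bCoeff p q Xn) := continuous_bCoeff hXn
  have h2 : Continuous (bCoeff p q Xm) := continuous_bCoeff hXm
  have h3 : Continuous fun θ => Real.exp (S θ / ((m : ℝ) - n)) := by fun_prop
  unfold orbitRate
  refine Continuous.div (by fun_prop) (by fun_prop) fun θ => ?_
  have h1 := hbn θ
  have h2 := hbm θ
  positivity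

/-- The extra factor e^u turns the exponents p + i - 1 and q + i - 1 into p + i and q + i, avoiding
natural subtraction. -/
theorem quasiHomogeneous_quasiPolar (hp : 1 ≤ p) (hq : 1 ≤ q) {i : ℕ}
    (hX : IsQuasiHomogeneous p q i X) (u θ : ℝ) :
    (X (quasiPolar p q (u, θ))).1 * Real.exp u =
        Real.exp (p * u) * Real.exp u ^ i * (X (Real.cos θ, Real.sin θ)).1 ∧
      (X (quasiPolar p q (u, θ))).2 * Real.exp u =
        Real.exp (q * u) * Real.exp u ^ i * (X (Real.cos θ, Real.sin θ)).2 := by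
  obtain ⟨h1, h2⟩ := hX (Real.exp u) (Real.cos θ) (Real.sin θ)
  rw [quasiPolar, Real.exp_nat_mul, Real.exp_nat_mul, h1, h2]
  constructor
  · rw [← pow_add, show p + i = (p + i - 1) + 1 by omega, pow_succ, Nat.add_sub_cancel]
    ring
  · rw [← pow_add, show q + i = (q + i - 1) + 1 by omega, pow_succ, Nat.add_sub_cancel]
    ring

/-- With w = p cos² + q sin², this rests on p cos (cos P + sin Q) - sin (p cos Q - q sin P) = w P
and q sin (cos P + sin Q) + cos (p cos Q - q sin P) = w Q. -/
theorem hasDerivAt_orbitCurve (hp : 1 ≤ p) (hq : 1 ≤ q) (hnm : n < m)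
    (hXn : IsQuasiHomogeneous p q n Xn) (hXm : IsQuasiHomogeneous p q m Xm)
    (hbn : ∀ θ, 0 < bCoeff p q Xn θ) (hbm : ∀ θ, 0 < bCoeff p q Xm θ) {S : ℝ → ℝ}
    (hS : ∀ θ, HasDerivAt S (orbitField p q n m Xn Xm θ (S θ)) θ) (θ : ℝ) :
    HasDerivAt (orbitCurve p q n m S) (orbitRate p q n m Xn Xm S θ •
      (Xn (orbitCurve p q n m S θ) + Xm (orbitCurve p q n m S θ))) θ := by
  have hmn : (0 : ℝ) < (m : ℝ) - n := by
    have : (n : ℝ) < m := by exact_mod_cast hnm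
    linarith
  have hu := (hS θ).div_const ((m : ℝ) - n)
  have hderiv := ((hu.const_mul (p : ℝ)).exp.mul (Real.hasDerivAt_cos θ)).prodMk
    ((hu.const_mul (q : ℝ)).exp.mul (Real.hasDerivAt_sin θ))
  refine hderiv.congr_deriv ?_
  rw [orbitField_eq hbn hbm, orbitRate, orbitCurve]
  set u := S θ / ((m : ℝ) - n) with hudef
  have hSu : Real.exp (S θ) = Real.exp u ^ m / Real.exp u ^ n := by
    rw [← Real.exp_nat_mul, ← Real.exp_nat_mul, ← Real.exp_sub, hudef]
    congr 1
    field_simp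
  obtain ⟨n1, n2⟩ := quasiHomogeneous_quasiPolar hp hq hXn u θ
  obtain ⟨m1, m2⟩ := quasiHomogeneous_quasiPolar hp hq hXm u θ
  have h1 := hbn θ
  have h2 := hbm θ
  have hE := Real.exp_pos u
  rw [hSu]
  set E := Real.exp u with hEdef
  set B := E ^ n * bCoeff p q Xn θ + E ^ m * bCoeff p q Xm θ with hB
  have hB0 : 0 < B := by positivity
  have hfield : (aCoeff n m Xn θ + aCoeff n m Xm θ * (E ^ m / E ^ n)) /
      (bCoeff p q Xn θ + bCoeff p q Xm θ * (E ^ m / E ^ n)) =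
      (E ^ n * aCoeff n m Xn θ + E ^ m * aCoeff n m Xm θ) / B := by
    rw [hB]
    field_simp
  rw [hfield]
  refine Prod.ext ?_ ?_
  · simp only [Prod.smul_fst, Prod.fst_add, smul_eq_mul]
    field_simp
    rw [hB, aCoeff, aCoeff, bCoeff, bCoeff]
    linear_combination -((m : ℝ) - n) * (p * Real.cos θ ^ 2 + q * Real.sin θ ^ 2) * (n1 + m1)
  · simp only [Prod.smul_snd, Prod.snd_add, smul_eq_mul]
    field_simp
    rw [hB, aCoeff, aCoeff, bCoeff, bCoeff]
    linear_combination -((m : ℝ) - n) * (p * Real.cos θ ^ 2 + q * Real.sin θ ^ 2) * (n2 + m2)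

end Polar

/-! ### From periodic solutions of the orbit equation to limit cycles -/

section LimitCycle

variable {p q n m : ℕ} {Xn Xm : ℝ × ℝ → ℝ × ℝ}

theorem orbitCurve_eq_solution (hp : 1 ≤ p) (hq : 1 ≤ q) (hnm : n < m)
    (hXn : IsQuasiHomogeneous p q n Xn) (hXm : IsQuasiHomogeneous p q m Xm)
    (hXn_smooth : ContDiffOn ℝ 1 Xn {0}ᶜ) (hXm_smooth : ContDiffOn ℝ 1 Xm {0}ᶜ)
    (hbn : ∀ θ, 0 < bCoeff p q Xn θ) (hbm : ∀ θ, 0 < bCoeff p q Xm θ) {S τ : ℝ → ℝ}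
    (hS : ∀ θ, HasDerivAt S (orbitField p q n m Xn Xm θ (S θ)) θ)
    (hτ : ∀ θ, HasDerivAt τ (orbitRate p q n m Xn Xm S θ) θ) {γ : ℝ → ℝ × ℝ}
    (hγ : ∀ t, HasDerivAt γ (Xn (γ t) + Xm (γ t)) t) {t₁ θ₁ : ℝ}
    (h : γ t₁ = orbitCurve p q n m S θ₁) (θ : ℝ) :
    γ (τ θ - τ θ₁ + t₁) = orbitCurve p q n m S θ := by
  have hSc : Continuous S := continuous_iff_continuousAt.2 fun t => (hS t).continuousAt
  exact solution_comp_eq (X := fun z => Xn z + Xm z) (hXn_smooth.add hXm_smooth) hγ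
    (hasDerivAt_orbitCurve hp hq hnm hXn hXm hbn hbm hS) (fun θ => quasiPolar_ne_zero _)
    (continuous_orbitRate hXn_smooth hXm_smooth hbn hbm hSc)
    (fun θ => ((hτ θ).sub_const (τ θ₁)).add_const t₁) (θ₀ := θ₁) (by simpa using h) θ

theorem orbitCurve_mem_range (hp : 1 ≤ p) (hq : 1 ≤ q) (hnm : n < m)
    (hXn : IsQuasiHomogeneous p q n Xn) (hXm : IsQuasiHomogeneous p q m Xm)
    (hXn_smooth : ContDiffOn ℝ 1 Xn {0}ᶜ) (hXm_smooth : ContDiffOn ℝ 1 Xm {0}ᶜ)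
    (hbn : ∀ θ, 0 < bCoeff p q Xn θ) (hbm : ∀ θ, 0 < bCoeff p q Xm θ) {S : ℝ → ℝ}
    (hS : ∀ θ, HasDerivAt S (orbitField p q n m Xn Xm θ (S θ)) θ) {γ : ℝ → ℝ × ℝ}
    (hγ : ∀ t, HasDerivAt γ (Xn (γ t) + Xm (γ t)) t) {θ₁ : ℝ}
    (h : orbitCurve p q n m S θ₁ ∈ range γ) (θ : ℝ) : orbitCurve p q n m S θ ∈ range γ := by
  have hSc : Continuous S := continuous_iff_continuousAt.2 fun t => (hS t).continuousAt
  have hk := continuous_orbitRate (n := n) (m := m) hXn_smooth hXm_smooth hbn hbm hSc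
  obtain ⟨t₁, ht₁⟩ := h
  exact ⟨_, orbitCurve_eq_solution hp hq hnm hXn hXm hXn_smooth hXm_smooth hbn hbm hS
    (τ := fun θ => ∫ x in (0 : ℝ)..θ, orbitRate p q n m Xn Xm S x)
    (fun θ => intervalIntegral.integral_hasDerivAt_right (hk.intervalIntegrable _ _)
      (hk.stronglyMeasurableAtFilter _ _) hk.continuousAt) hγ ht₁ θ⟩

theorem periodic_orbitCurve {S : ℝ → ℝ} (hSper : Function.Periodic S (2 * Real.pi)) :
    Function.Periodic (orbitCurve p q n m S) (2 * Real.pi) := fun θ => by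
  rw [orbitCurve, hSper θ, quasiPolar_add_two_pi, ← orbitCurve]

theorem injOn_orbitCurve (hp : 1 ≤ p) (hq : 1 ≤ q) (S : ℝ → ℝ) :
    InjOn (orbitCurve p q n m S) (Ico 0 (2 * Real.pi)) := by
  intro a ha b hb h
  obtain ⟨-, k, hk⟩ := quasiPolar_inj hp hq h
  have hπ := Real.two_pi_pos
  have h1 : (k : ℝ) < 1 := by
    by_contra! hcon
    nlinarith [ha.2, hb.1]
  have h2 : (-1 : ℝ) < k := by
    by_contra! hcon
    nlinarith [ha.1, hb.2]
  have h1' : k < 1 := by exact_mod_cast h1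
  have h2' : -1 < k := by exact_mod_cast h2
  obtain rfl : k = 0 := by omega
  simpa using hk

theorem periodic_orbitRate {S : ℝ → ℝ} (hSper : Function.Periodic S (2 * Real.pi)) :
    Function.Periodic (orbitRate p q n m Xn Xm S) (2 * Real.pi) := fun θ => by
  simp only [orbitRate, hSper θ, periodic_bCoeff θ, Real.cos_add_two_pi, Real.sin_add_two_pi]

/-- A periodic solution of the orbit equation gives a periodic orbit, and every solution of the
planar system that meets this orbit runs through exactly this orbit. -/
theorem isPeriodicOrbit_orbitCurve (hp : 1 ≤ p) (hq : 1 ≤ q) (hnm : n < m)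
    (hXn : IsQuasiHomogeneous p q n Xn) (hXm : IsQuasiHomogeneous p q m Xm)
    (hXn_smooth : ContDiffOn ℝ 1 Xn {0}ᶜ) (hXm_smooth : ContDiffOn ℝ 1 Xm {0}ᶜ)
    (hbn : ∀ θ, 0 < bCoeff p q Xn θ) (hbm : ∀ θ, 0 < bCoeff p q Xm θ) {S : ℝ → ℝ}
    (hS : ∀ θ, HasDerivAt S (orbitField p q n m Xn Xm θ (S θ)) θ)
    (hSper : Function.Periodic S (2 * Real.pi)) :
    IsPeriodicOrbit (fun z => Xn z + Xm z) (range (orbitCurve p q n m S)) ∧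
      ∀ γ : ℝ → ℝ × ℝ, (∀ t, HasDerivAt γ (Xn (γ t) + Xm (γ t)) t) →
        (∃ θ, orbitCurve p q n m S θ ∈ range γ) → range γ = range (orbitCurve p q n m S) := by
  have hSc : Continuous S := continuous_iff_continuousAt.2 fun t => (hS t).continuousAt
  have hpos := orbitRate_pos (n := n) (m := m) hp hq hbn hbm S
  obtain ⟨τ, φ, T, hT, hτ, hφτ, hτφ, hφ, hφmono, hφ0, hφT⟩ := exists_time_change
    (continuous_orbitRate (n := n) (m := m) hXn_smooth hXm_smooth hbn hbm hSc) hpos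
    Real.two_pi_pos (periodic_orbitRate hSper)
  have hφsurj : Function.Surjective φ := hφτ.surjective
  refine ⟨⟨fun t => orbitCurve p q n m S (φ t), T, hT, fun t => ?_, fun t => ?_, ?_, ?_⟩, ?_⟩
  · have h1 := (hasDerivAt_orbitCurve hp hq hnm hXn hXm hbn hbm hS (φ t)).scomp t (hφ t)
    refine h1.congr_deriv ?_
    rw [smul_smul, inv_mul_cancel₀ (hpos _).ne', one_smul]
  · simp only [hφT]
    exact periodic_orbitCurve hSper _
  · have hmaps : MapsTo φ (Ico 0 T) (Ico 0 (2 * Real.pi)) := by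
      intro t ht
      have hφT' : φ T = 2 * Real.pi := by simpa [hφ0] using hφT 0
      exact ⟨hφ0 ▸ hφmono.monotone ht.1, hφT' ▸ hφmono ht.2⟩
    exact (injOn_orbitCurve hp hq S).comp hφmono.injective.injOn hmaps
  · exact (hφsurj.range_comp _).symm
  · rintro γ hγ ⟨θ₁, t₁, ht₁⟩
    have key := orbitCurve_eq_solution hp hq hnm hXn hXm hXn_smooth hXm_smooth hbn hbm hS hτ hγ ht₁
    refine Subset.antisymm ?_ ?_
    · rintro _ ⟨t, rfl⟩
      refine ⟨φ (t - t₁ + τ θ₁), ?_⟩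
      rw [← key, hτφ]
      congr 1
      ring
    · rintro _ ⟨θ, rfl⟩
      exact ⟨_, key θ⟩

theorem exists_limitCycle_of_pos (hp : 1 ≤ p) (hq : 1 ≤ q) (hnm : n < m)
    (hXn : IsQuasiHomogeneous p q n Xn) (hXm : IsQuasiHomogeneous p q m Xm)
    (hXn_smooth : ContDiffOn ℝ 1 Xn {0}ᶜ) (hXm_smooth : ContDiffOn ℝ 1 Xm {0}ᶜ)
    (hbn : ∀ θ, 0 < bCoeff p q Xn θ) (hbm : ∀ θ, 0 < bCoeff p q Xm θ)
    (hint : (∫ θ in (0 : ℝ)..(2 * Real.pi), aCoeff n m Xn θ / bCoeff p q Xn θ) *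
      (∫ θ in (0 : ℝ)..(2 * Real.pi), aCoeff n m Xm θ / bCoeff p q Xm θ) < 0) :
    ∃ Γ : Set (ℝ × ℝ), IsLimitCycle (fun z => Xn z + Xm z) Γ ∧ SurroundsOrigin Γ := by
  have hmn : (0 : ℝ) < (m : ℝ) - n := by
    have : (n : ℝ) < m := by exact_mod_cast hnm
    linarith
  have hπ := Real.two_pi_pos
  set α : ℝ → ℝ := fun θ => aCoeff n m Xn θ / bCoeff p q Xn θ with hα
  set β : ℝ → ℝ := fun θ => aCoeff n m Xm θ / bCoeff p q Xm θ with hβ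
  set l : ℝ → ℝ := fun θ => Real.log (bCoeff p q Xm θ / bCoeff p q Xn θ) with hl
  have hαc : Continuous α :=
    (continuous_aCoeff hXn_smooth).div (continuous_bCoeff hXn_smooth) fun θ => (hbn θ).ne'
  have hβc : Continuous β :=
    (continuous_aCoeff hXm_smooth).div (continuous_bCoeff hXm_smooth) fun θ => (hbm θ).ne'
  have hlc : Continuous l :=
    ((continuous_bCoeff hXm_smooth).div (continuous_bCoeff hXn_smooth) fun θ => (hbn θ).ne').log
      fun θ => (div_pos (hbm θ) (hbn θ)).ne'
  have hαp : Function.Periodic α (2 * Real.pi) := fun θ => by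
    simp only [hα, periodic_aCoeff θ, periodic_bCoeff θ]
  have hβp : Function.Periodic β (2 * Real.pi) := fun θ => by
    simp only [hβ, periodic_aCoeff θ, periodic_bCoeff θ]
  have hlp : Function.Periodic l (2 * Real.pi) := fun θ => by
    simp only [hl, periodic_bCoeff θ]
  obtain ⟨Cα, hCα⟩ := hαp.exists_abs_le hαc hπ.ne'
  obtain ⟨Cβ, hCβ⟩ := hβp.exists_abs_le hβc hπ.ne'
  obtain ⟨M, hMα, hMβ⟩ : ∃ M : ℝ≥0, (∀ t, |α t| ≤ M) ∧ ∀ t, |β t| ≤ M :=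
    ⟨max Cα Cβ, fun t => (hCα t).trans (by exact_mod_cast le_max_left _ _),
      fun t => (hCβ t).trans (by exact_mod_cast le_max_right _ _)⟩
  set F : ℝ → ℝ → ℝ := orbitField p q n m Xn Xm with hF
  have hL : ∀ t, LipschitzWith (8 * M) (F t) := lipschitzWith_logisticField hMα hMβ
  have hFper : ∀ t s, F (t + 2 * Real.pi) s = F t s := fun t s => by
    change logisticField α β l _ _ = logisticField α β l _ _
    simp only [logisticField, hαp t, hβp t, hlp t]
  have hglobal := exists_global_solution (F := F) (continuous_logisticField hαc hβc hlc) hL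
    (abs_logisticField_le hMα hMβ)
  choose Φ hΦ0 hΦ using hglobal 0
  obtain ⟨s₀, hs₀, ε, hε, hiso⟩ :=
    exists_isolated_fixedPoint hαc hβc hlc hMα hMβ hΦ0 hΦ hπ.le hint
  have hshift : ∀ s t, HasDerivAt (fun t => Φ s (t + 2 * Real.pi)) (F t (Φ s (t + 2 * Real.pi))) t := by
    intro s t
    have := (hΦ s (t + 2 * Real.pi)).comp_add_const t (2 * Real.pi)
    rwa [hFper] at this
  have hS₀per : Function.Periodic (Φ s₀) (2 * Real.pi) := by
    have := solution_unique hL (hshift s₀) (hΦ s₀) (t₀ := 0) (by simp [hs₀, hΦ0])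
    exact fun t => congrFun this t
  have hS₀c : Continuous (Φ s₀) := continuous_iff_continuousAt.2 fun t => (hΦ s₀ t).continuousAt
  obtain ⟨horbit, hunique⟩ := isPeriodicOrbit_orbitCurve hp hq hnm hXn hXm hXn_smooth hXm_smooth
    hbn hbm (hΦ s₀) hS₀per
  have hmem : ∀ {S : ℝ → ℝ} {γ : ℝ → ℝ × ℝ}, (∀ t, HasDerivAt S (F t (S t)) t) →
      (∀ t, HasDerivAt γ (Xn (γ t) + Xm (γ t)) t) → ∀ {θ₁ : ℝ},
      orbitCurve p q n m S θ₁ ∈ range γ → ∀ θ, orbitCurve p q n m S θ ∈ range γ :=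
    fun hS hγ _ h => orbitCurve_mem_range hp hq hnm hXn hXm hXn_smooth hXm_smooth hbn hbm hS hγ h
  refine ⟨range (orbitCurve p q n m (Φ s₀)), ⟨horbit, ?_⟩,
    surroundsOrigin_starCurve (v := fun θ => Φ s₀ θ / ((m : ℝ) - n)) hp hq
      (hS₀c.div_const _) fun θ => by simp only [hS₀per θ]⟩
  -- Angles are taken in (-π, π], so r bounds the Gronwall factor for transport to angle 0;
  -- deviations below ε / r become deviations below ε.
  set r : ℝ := Real.exp ((8 * M : ℝ≥0) * Real.pi) with hr
  have hr0 : 0 < r := Real.exp_pos _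
  refine ⟨quasiPolar p q '' {w | |((m : ℝ) - n) * w.1 - Φ s₀ w.2| < ε / r},
    isOpenMap_quasiPolar hp hq _ (isOpen_lt (by fun_prop) continuous_const), ?_, ?_⟩
  · rintro _ ⟨θ, rfl⟩
    refine ⟨(Φ s₀ θ / ((m : ℝ) - n), θ), ?_, rfl⟩
    rw [mem_ofPred_eq, mul_div_cancel₀ _ hmn.ne', sub_self, abs_zero]
    positivity
  rintro Γ' ⟨γ, T, hT, hγ, hγper, -, rfl⟩ ⟨z, hzγ, ⟨u, η⟩, hw, hwz⟩
  -- a solution of the orbit equation through the given point, with initial value `s` near `s₀`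
  obtain ⟨s, hs, hsγ⟩ : ∃ s, |s - s₀| < ε ∧ orbitCurve p q n m (Φ s) 0 ∈ range γ := by
    obtain ⟨u', θ, hθ, hθz⟩ := exists_quasiPolar_eq hp hq (hwz ▸ quasiPolar_ne_zero (u, η))
    obtain ⟨rfl, hv⟩ := eq_and_apply_eq_of_quasiPolar_eq hp hq hS₀per (hθz.trans hwz.symm)
    rw [mem_ofPred_eq, ← hv] at hw
    obtain ⟨S, hSθ, hS⟩ := hglobal θ (((m : ℝ) - n) * u')
    have hSΦ : S = Φ (S 0) := solution_unique hL hS (hΦ _) (t₀ := 0) (by rw [hΦ0])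
    refine ⟨S 0, ?_, ?_⟩
    · have h1 : dist (S 0) (Φ s₀ 0) ≤ dist (S θ) (Φ s₀ θ) * r := by
        rcases le_total 0 θ with h | h
        · refine (dist_solution_le' hL hS (hΦ s₀) h).trans ?_
          rw [hr]
          have : θ - 0 ≤ Real.pi := by linarith [hθ.2]
          gcongr
        · refine (dist_solution_le hL hS (hΦ s₀) h).trans ?_
          rw [hr]
          have : 0 - θ ≤ Real.pi := by linarith [hθ.1]
          gcongr
      rw [hΦ0, hSθ, Real.dist_eq, Real.dist_eq] at h1
      exact h1.trans_lt ((lt_div_iff₀ hr0).1 hw)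
    · rw [← hSΦ]
      refine hmem hS hγ (θ₁ := θ) ?_ 0
      rw [orbitCurve, hSθ, mul_div_cancel_left₀ _ hmn.ne', hθz]
      exact hzγ
  -- among the initial values on `γ`, take the closest one to `s₀`
  have hγc : Continuous γ := continuous_iff_continuousAt.2 fun t => (hγ t).continuousAt
  have hclosed : IsClosed (range γ) := (hγper.compact_of_continuous hT.ne' hγc).isClosed
  set ι : ℝ → ℝ × ℝ := fun s => quasiPolar p q (s / ((m : ℝ) - n), 0) with hι
  have hιc : Continuous ι := by
    simp only [hι, quasiPolar]
    fun_prop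
  have hι0 : ∀ s, orbitCurve p q n m (Φ s) 0 = ι s := fun s => by rw [orbitCurve, hΦ0]
  have hι2 : ∀ s, orbitCurve p q n m (Φ s) (2 * Real.pi) = ι (Φ s (2 * Real.pi)) := fun s => by
    rw [orbitCurve, hι]
    simpa using quasiPolar_add_two_pi (p := p) (q := q) (Φ s (2 * Real.pi) / ((m : ℝ) - n)) 0
  have hι3 : ∀ s, orbitCurve p q n m (Φ s) (-(2 * Real.pi)) = ι (Φ s (-(2 * Real.pi))) := fun s => by
    rw [orbitCurve, hι]
    simpa using (quasiPolar_add_two_pi (p := p) (q := q)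
      (Φ s (-(2 * Real.pi)) / ((m : ℝ) - n)) (-(2 * Real.pi))).symm
  have hcompact : IsCompact (Metric.closedBall s₀ |s - s₀| ∩ ι ⁻¹' range γ) :=
    (isCompact_closedBall _ _).inter_right (hclosed.preimage hιc)
  obtain ⟨x, ⟨hxs, hxγ⟩, hxmin⟩ := hcompact.exists_isMinOn
    ⟨s, by simp [Real.dist_eq], by rw [mem_preimage, ← hι0]; exact hsγ⟩
    (f := fun x => |x - s₀|) (by fun_prop)
  have hxs' : |x - s₀| ≤ |s - s₀| := by simpa [Real.dist_eq] using hxs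
  have hmin : ∀ y, ι y ∈ range γ → |x - s₀| ≤ |y - s₀| := by
    intro y hy
    by_contra! hcon
    exact absurd (isMinOn_iff.1 hxmin y
      ⟨by simpa [Real.dist_eq] using (hcon.trans_le hxs').le, hy⟩) (not_le.2 hcon)
  have hxall := hmem (hΦ x) hγ (θ₁ := 0) (by rw [hι0]; exact hxγ)
  have hmin2 := hmin _ (hι2 x ▸ hxall (2 * Real.pi))
  have hmin3 := hmin _ (hι3 x ▸ hxall (-(2 * Real.pi)))
  -- Images of x under the return map and its inverse stay on the same side of s₀ and, by
  -- minimality, are no closer to it. If the return map moves x strictly away, monotonicity makes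
  -- the inverse move it strictly closer, a contradiction.
  have hxs₀ : x = s₀ := by
    by_contra hne
    have hfix : Φ x (2 * Real.pi) ≠ x := fun h => hne (hiso x (hxs'.trans_lt hs) h)
    have hback : Φ s₀ (-(2 * Real.pi)) = s₀ := by
      have := hS₀per (-(2 * Real.pi))
      rw [neg_add_cancel, hΦ0] at this
      exact this.symm
    rcases lt_or_gt_of_ne hne with hlt | hlt
    · have h2 := solution_lt hL (hΦ x) (hΦ s₀) (a := 0) (by rwa [hΦ0, hΦ0]) (2 * Real.pi)
      have h3 := solution_lt hL (hΦ x) (hΦ s₀) (a := 0) (by rwa [hΦ0, hΦ0]) (-(2 * Real.pi))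
      rw [hs₀] at h2
      rw [hback] at h3
      rw [abs_of_neg (sub_neg.2 hlt), abs_of_neg (sub_neg.2 h2)] at hmin2
      rw [abs_of_neg (sub_neg.2 hlt), abs_of_neg (sub_neg.2 h3)] at hmin3
      have h4 := solution_lt hL (hshift x) (hΦ x) (a := 0)
        (by simpa [hΦ0] using lt_of_le_of_ne (by linarith) hfix) (-(2 * Real.pi))
      rw [neg_add_cancel, hΦ0] at h4
      linarith
    · have h2 := solution_lt hL (hΦ s₀) (hΦ x) (a := 0) (by rwa [hΦ0, hΦ0]) (2 * Real.pi)
      have h3 := solution_lt hL (hΦ s₀) (hΦ x) (a := 0) (by rwa [hΦ0, hΦ0]) (-(2 * Real.pi))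
      rw [hs₀] at h2
      rw [hback] at h3
      rw [abs_of_pos (sub_pos.2 hlt), abs_of_pos (sub_pos.2 h2)] at hmin2
      rw [abs_of_pos (sub_pos.2 hlt), abs_of_pos (sub_pos.2 h3)] at hmin3
      have h4 := solution_lt hL (hΦ x) (hshift x) (a := 0)
        (by simpa [hΦ0] using lt_of_le_of_ne (by linarith) hfix.symm) (-(2 * Real.pi))
      rw [neg_add_cancel, hΦ0] at h4
      linarith
  exact hunique γ hγ ⟨0, by rw [← hxs₀]; exact hxall 0⟩

end LimitCycle

/-! ### Time reversal and the general case -/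

theorem IsPeriodicOrbit.neg {X : ℝ × ℝ → ℝ × ℝ} {Γ : Set (ℝ × ℝ)} (h : IsPeriodicOrbit X Γ) :
    IsPeriodicOrbit (fun z => -X z) Γ := by
  obtain ⟨γ, T, hT, hγ, hper, hinj, rfl⟩ := h
  refine ⟨fun t => γ (-t), T, hT, fun t => ?_, fun t => ?_, fun a ha b hb hab => ?_, ?_⟩
  · simpa [Function.comp_def] using (hγ (-t)).scomp t (hasDerivAt_neg t)
  · simp only [neg_add]
    exact hper.neg (-t)
  -- Reversal sends [0, T) to (-T, 0]; a shift by T returns it to [0, T), except that 0 stays fixed.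
  · have hmod : ∀ t ∈ Ico 0 T, ∃ t' ∈ Ico 0 T, γ t' = γ (-t) ∧
        (t = 0 ∧ t' = 0 ∨ 0 < t ∧ t' = T - t) := by
      intro t ht
      rcases ht.1.eq_or_lt with h0 | h0
      · exact ⟨0, ⟨le_rfl, hT⟩, by rw [← h0, neg_zero], Or.inl ⟨h0.symm, rfl⟩⟩
      · refine ⟨T - t, ⟨by linarith [ht.2], by linarith⟩, ?_, Or.inr ⟨h0, rfl⟩⟩
        rw [sub_eq_neg_add]
        exact hper (-t)
    obtain ⟨a', ha', haγ, hac⟩ := hmod a ha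
    obtain ⟨b', hb', hbγ, hbc⟩ := hmod b hb
    have := hinj ha' hb' (by rw [haγ, hbγ]; exact hab)
    rcases hac with ⟨h1, h2⟩ | ⟨h1, h2⟩ <;> rcases hbc with ⟨h3, h4⟩ | ⟨h3, h4⟩ <;>
      linarith [ha.2, hb.2]
  · exact (neg_surjective.range_comp γ).symm

theorem isPeriodicOrbit_neg_iff {X : ℝ × ℝ → ℝ × ℝ} {Γ : Set (ℝ × ℝ)} :
    IsPeriodicOrbit (fun z => -X z) Γ ↔ IsPeriodicOrbit X Γ :=
  ⟨fun h => by simpa using h.neg, fun h => h.neg⟩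

theorem isLimitCycle_neg_iff {X : ℝ × ℝ → ℝ × ℝ} {Γ : Set (ℝ × ℝ)} :
    IsLimitCycle (fun z => -X z) Γ ↔ IsLimitCycle X Γ := by
  simp only [IsLimitCycle, isPeriodicOrbit_neg_iff]

theorem IsQuasiHomogeneous.neg {p q i : ℕ} {X : ℝ × ℝ → ℝ × ℝ} (h : IsQuasiHomogeneous p q i X) :
    IsQuasiHomogeneous p q i (fun z => -X z) := fun l x y => by
  obtain ⟨h1, h2⟩ := h l x y
  simp only [Prod.fst_neg, Prod.snd_neg, h1, h2, mul_neg, and_self]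

theorem aCoeff_neg (n m : ℕ) (X : ℝ × ℝ → ℝ × ℝ) (θ : ℝ) :
    aCoeff n m (fun z => -X z) θ = -aCoeff n m X θ := by
  simp only [aCoeff, Prod.fst_neg, Prod.snd_neg]
  ring

theorem bCoeff_neg (p q : ℕ) (X : ℝ × ℝ → ℝ × ℝ) (θ : ℝ) :
    bCoeff p q (fun z => -X z) θ = -bCoeff p q X θ := by
  simp only [bCoeff, Prod.fst_neg, Prod.snd_neg]
  ring

theorem proposition2 (p q n m : ℕ) (hp : 1 ≤ p) (hq : 1 ≤ q) (hnm : n < m)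
    (Xn Xm : ℝ × ℝ → ℝ × ℝ)
    (hXn : IsQuasiHomogeneous p q n Xn) (hXm : IsQuasiHomogeneous p q m Xm)
    (hXn_smooth : ContDiffOn ℝ 1 Xn {0}ᶜ) (hXm_smooth : ContDiffOn ℝ 1 Xm {0}ᶜ)
    (hb : ∀ θ : ℝ, 0 < bCoeff p q Xn θ * bCoeff p q Xm θ)
    (hint : (∫ θ in (0 : ℝ)..(2 * Real.pi), aCoeff n m Xn θ / bCoeff p q Xn θ) *
      (∫ θ in (0 : ℝ)..(2 * Real.pi), aCoeff n m Xm θ / bCoeff p q Xm θ) < 0) :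
    ∃ Γ : Set (ℝ × ℝ), IsLimitCycle (fun z => Xn z + Xm z) Γ ∧ SurroundsOrigin Γ := by
  have hne : ∀ θ, bCoeff p q Xn θ ≠ 0 := fun θ h => by simpa [h] using hb θ
  have hc : Continuous (bCoeff p q Xn) := continuous_bCoeff hXn_smooth
  -- b_n is continuous without zeros, so its sign is constant. Negating both fields reverses time
  -- and leaves the quotients a_i / b_i unchanged.
  by_cases hsign : ∀ θ, 0 < bCoeff p q Xn θ
  · exact exists_limitCycle_of_pos hp hq hnm hXn hXm hXn_smooth hXm_smooth hsign
      (fun θ => (mul_pos_iff_of_pos_left (hsign θ)).1 (hb θ)) hint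
  · have hneg : ∀ θ, bCoeff p q Xn θ < 0 := by
      push Not at hsign
      obtain ⟨a, ha⟩ := hsign
      intro θ
      by_contra! hcon
      obtain ⟨b, hb0⟩ := mem_range_of_exists_le_of_exists_ge hc ⟨a, ha⟩ ⟨θ, hcon⟩
      exact hne b hb0
    obtain ⟨Γ, hΓ, hΓ0⟩ := exists_limitCycle_of_pos hp hq hnm hXn.neg hXm.neg hXn_smooth.neg
      hXm_smooth.neg (fun θ => by rw [bCoeff_neg]; exact neg_pos.2 (hneg θ))
      (fun θ => by rw [bCoeff_neg]; exact neg_pos.2 (neg_of_mul_pos_right (hb θ) (hneg θ).le))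
      (by simpa only [aCoeff_neg, bCoeff_neg, neg_div_neg_eq] using hint)
    refine ⟨Γ, isLimitCycle_neg_iff.1 ?_, hΓ0⟩
    simpa only [neg_add] using hΓ
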